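/- Consider a unit-cost random access machine over the real numbers with the operations $+,-,\cdot,/$, rounding down $\lfloor\cdot\rfloor$, comparisons, integer constants and indexed memory access; every executed operation (including the bookkeeping on indices) is counted. A program is fixed and does not depend on its input. For a subroutine $\mathtt{construct\_basis}$, which replaces linearly independent vectors $b_1,\dots,b_k\in\mathbb R^n$ and a further vector $v$ by a basis of the lattice $\langle b_1,\dots,b_k,v\rangle_{\mathbb Z}$ whenever this lattice is integral, let the *incremental basis algorithm with sieving* be the following program. Start with the empty list of basis vectors ($k=0$) and $A=I_n$. For $i=1,\dots,s$ put $v=v_i$ and compute $Av$, where $A=(b_1\cdots b_k\,w_1\cdots w_{n-k})^{-1}$ and $w_1,\dots,w_{n-k}$ is a basis of a complement of $\langle b_1,\dots,b_k\rangle_{\mathbb R}$. If the first $k$ coordinates of $Av$ are integers and the remaining ones are $0$ (i.e. $v\in\langle b_1,\dots,b_k\rangle_{\mathbb Z}$), discard $v$; otherwise replace $(b_1,\dots,b_k)$ by the result of $\mathtt{construct\_basis}(b_1,\dots,b_k,v)$ and recompute $A$ by Gaussian elimination. **Theorem.** There are a correct subroutine $\mathtt{construct\_basis}$ (a fixed program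 of the machine) and a constant $C$ such that the following holds for all $n\ge 1$, $s$ and $B\in\mathbb R$. Let $L\subset\mathbb R^n$ be a lattice of full rank $n$ which is integral, i.e. $(x,y)\in\mathbb Z$ for all $x,y\in L$ with respect to the standard inner product, and let $L$ be generated by vectors $v_1,\dots,v_s$ of Euclidean norm $\|v_i\|\le B$. Then the incremental basis algorithm with sieving, with this subroutine and on input $n,s,v_1,\dots,v_s$, halts after at most $$C\,\bigl(n^6\log^2(nB)+s\,n^2\bigr)$$ operations, and its output is a $\mathbb Z$-basis $b_1,\dots,b_n$ of $L$. -/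

import Mathlib

/-!  A unit-cost random access machine over the real numbers, programmed in a small while-language,
and the incremental basis algorithm with sieving as a program of that machine. -/

namespace RealRam

/-- The memory: infinitely many arrays of real numbers; `σ a m` is cell `m` of array `a`. -/
abbrev Memory : Type := ℕ → ℕ → ℝ

/-- Expressions: integer constants, memory cells with a computed index, the four arithmetic
operations, and rounding down. -/
inductive Expr : Type
  | lit (z : ℤ)
  | get (a : ℕ) (m : Expr)
  | add (x y : Expr)
  | sub (x y : Expr)
  | mul (x y : Expr)
  | div (x y : Expr)
  | floor (x : Expr)

/-- The value of an expression (an index is rounded down to a natural number; `x / 0 = 0`). -/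
noncomputable def Expr.eval (σ : Memory) : Expr → ℝ
  | .lit z => (z : ℝ)
  | .get a m => σ a ⌊m.eval σ⌋₊
  | .add x y => x.eval σ + y.eval σ
  | .sub x y => x.eval σ - y.eval σ
  | .mul x y => x.eval σ * y.eval σ
  | .div x y => x.eval σ / y.eval σ
  | .floor x => (⌊x.eval σ⌋ : ℝ)

/-- Every constant, memory access and operation in an expression costs one unit. -/
def Expr.cost : Expr → ℕ
  | .lit _ => 1
  | .get _ m => m.cost + 1
  | .add x y => x.cost + y.cost + 1
  | .sub x y => x.cost + y.cost + 1
  | .mul x y => x.cost + y.cost + 1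
  | .div x y => x.cost + y.cost + 1
  | .floor x => x.cost + 1

/-- The tests on which a program may branch. -/
inductive Test : Type
  | lt (x y : Expr)
  | eq (x y : Expr)

def Test.Holds (σ : Memory) : Test → Prop
  | .lt x y => x.eval σ < y.eval σ
  | .eq x y => x.eval σ = y.eval σ

def Test.cost : Test → ℕ
  | .lt x y => x.cost + y.cost + 1
  | .eq x y => x.cost + y.cost + 1

/-- Programs. A program is a finite object; it does not depend on its input or on its size. -/
inductive Prog : Type
  | skip
  | assign (a : ℕ) (m e : Expr)
  | seq (P Q : Prog)
  | branch (b : Test) (P Q : Prog)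
  | loop (b : Test) (P : Prog)

/-- The memory `σ` after writing `x` to cell `m` of array `a`. -/
def write (σ : Memory) (a m : ℕ) (x : ℝ) : Memory :=
  Function.update σ a (Function.update (σ a) m x)

/-- `Exec P σ t τ`: started in the memory `σ`, the program `P` halts after `t` operations in the
memory `τ`. All operations are counted: arithmetic, comparisons, memory accesses, constants, and
the operations spent on indices and loop counters. -/
inductive Exec : Prog → Memory → ℕ → Memory → Prop
  | skip (σ : Memory) : Exec .skip σ 0 σ
  | assign (a : ℕ) (m e : Expr) (σ : Memory) :
      Exec (.assign a m e) σ (m.cost + e.cost + 1) (write σ a ⌊m.eval σ⌋₊ (e.eval σ))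
  | seq (P Q : Prog) (σ τ υ : Memory) (t u : ℕ) :
      Exec P σ t τ → Exec Q τ u υ → Exec (.seq P Q) σ (t + u) υ
  | branch_true (b : Test) (P Q : Prog) (σ τ : Memory) (t : ℕ) :
      b.Holds σ → Exec P σ t τ → Exec (.branch b P Q) σ (b.cost + t) τ
  | branch_false (b : Test) (P Q : Prog) (σ τ : Memory) (t : ℕ) :
      ¬ b.Holds σ → Exec Q σ t τ → Exec (.branch b P Q) σ (b.cost + t) τ
  | loop_stop (b : Test) (P : Prog) (σ : Memory) :
      ¬ b.Holds σ → Exec (.loop b P) σ b.cost σ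
  | loop_step (b : Test) (P : Prog) (σ τ υ : Memory) (t u : ℕ) :
      b.Holds σ → Exec P σ t τ → Exec (.loop b P) τ u υ →
      Exec (.loop b P) σ (b.cost + t + u) υ

/-! ### Abbreviations for writing programs

Scalar variables are the cells of array `0`. -/

/-- The scalar variable number `x`. -/
def var (x : ℕ) : Expr := .get 0 (.lit x)

/-- Assignment to the scalar variable number `x`. -/
def setVar (x : ℕ) (e : Expr) : Prog := .assign 0 (.lit x) e

/-- Consecutive execution. -/
def block : List Prog → Prog
  | [] => .skip
  | P :: l => .seq P (block l)

/-- `for x = 0, …, e - 1 do P`. -/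
def forLoop (x : ℕ) (e : Expr) (P : Prog) : Prog :=
  block [setVar x (.lit 0),
    .loop (.lt (var x) e) (.seq P (setVar x (.add (var x) (.lit 1))))]

/-! ### Memory layout

Scalars: the dimension `n`, the number `s` of generators, the current number `k` of basis vectors,
and auxiliary variables. A vector with number `i` in an array occupies the cells
`i * n, …, i * n + n - 1`. Arrays with number at least `6` are workspace of the subroutine. -/

def N : ℕ := 0
def S : ℕ := 1
def K : ℕ := 2
def I : ℕ := 3
def Flag : ℕ := 4
def R : ℕ := 5
def J : ℕ := 6
def Col : ℕ := 7
def Piv : ℕ := 8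
def Tmp : ℕ := 9

/-- The array of the input vectors `v₁, …, v_s`. -/
def Gens : ℕ := 1
/-- The array of the current basis vectors `b₁, …, b_k`. -/
def Bas : ℕ := 2
/-- The array of the vector `v` under consideration. -/
def Vec : ℕ := 3
/-- The `n × n` matrix `A`, row by row. -/
def Mat : ℕ := 4
/-- The array of the product `A v`. -/
def Out : ℕ := 5

/-- The cell index `i * n + j`. -/
def idx (i j : ℕ) : Expr := .add (.mul (var i) (var N)) (var j)

/-- Copy vector number `i` of the array `a` to `Vec`. -/
def fetch (a i : ℕ) : Prog :=
  forLoop J (var N) (.assign Vec (var J) (.get a (idx i J)))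

/-- `A := 1`. -/
def setOne : Prog :=
  forLoop R (var N) (forLoop J (var N)
    (.branch (.eq (var R) (var J))
      (.assign Mat (idx R J) (.lit 1))
      (.assign Mat (idx R J) (.lit 0))))

/-- `Out := A v`, where `v` is the vector in `Vec`. -/
def mulVec : Prog :=
  forLoop R (var N) (block
    [setVar Tmp (.lit 0),
     forLoop J (var N)
       (setVar Tmp (.add (var Tmp) (.mul (.get Mat (idx R J)) (.get Vec (var J))))),
     .assign Out (var R) (var Tmp)])

/-- `Flag := 1` if the first `k` coordinates of `A v` are integers and the others are `0`,
that is, if `v` is an integral combination of `b₁, …, b_k`; otherwise `Flag := 0`. -/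
def sieveTest : Prog :=
  block
    [mulVec,
     setVar Flag (.lit 1),
     forLoop R (var N)
       (.branch (.lt (var R) (var K))
         (.branch (.eq (.floor (.get Out (var R))) (.get Out (var R)))
           .skip (setVar Flag (.lit 0)))
         (.branch (.eq (.get Out (var R)) (.lit 0))
           .skip (setVar Flag (.lit 0))))]

/-- Recompute `A = (b₁ … b_k w₁ … w_{n-k})⁻¹`, with `w₁, …, w_{n-k}` a basis of a complement of
the span of `b₁, …, b_k`, by Gaussian elimination with pivot search: for each column
`c`, row operations on `A` turn `A b_c` into the `c`-th unit vector. -/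
def updateInverse : Prog :=
  block
    [setOne,
     forLoop Col (var K) (block
       [fetch Bas Col,
        mulVec,
        setVar Piv (var Col),
        .loop (.eq (.get Out (var Piv)) (.lit 0)) (setVar Piv (.add (var Piv) (.lit 1))),
        forLoop J (var N) (block
          [setVar Tmp (.get Mat (idx Piv J)),
           .assign Mat (idx Piv J) (.get Mat (idx Col J)),
           .assign Mat (idx Col J) (var Tmp)]),
        setVar Tmp (.get Out (var Piv)),
        .assign Out (var Piv) (.get Out (var Col)),
        forLoop J (var N)
          (.assign Mat (idx Col J) (.div (.get Mat (idx Col J)) (var Tmp))),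
        forLoop R (var N)
          (.branch (.eq (var R) (var Col)) .skip
            (forLoop J (var N)
              (.assign Mat (idx R J)
                (.sub (.get Mat (idx R J))
                  (.mul (.get Out (var R)) (.get Mat (idx Col J)))))))])]

/-- The incremental basis algorithm with sieving, for a given subroutine `constructBasis`:
start with the empty basis; a generator in the lattice generated by the current basis
is discarded, any other one is handed to the subroutine together with the current basis. -/
def sieveBasis (constructBasis : Prog) : Prog :=
  block
    [setVar K (.lit 0),
     setOne,
     forLoop I (var S) (block
       [fetch Gens I,
        sieveTest,
        .branch (.eq (var Flag) (.lit 0))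
          (.seq constructBasis updateInverse)
          .skip])]

/-! ### Specifications -/

/-- The vector number `i` in the array `a`, for the dimension `n`. -/
def vecAt (σ : Memory) (a n i : ℕ) : EuclideanSpace ℝ (Fin n) :=
  WithLp.toLp 2 (fun j : Fin n => σ a (i * n + j))

/-- All inner products of elements of `L` are integers. -/
def IsIntegral {n : ℕ} (L : Submodule ℤ (EuclideanSpace ℝ (Fin n))) : Prop :=
  ∀ x ∈ L, ∀ y ∈ L, ∃ m : ℤ, inner ℝ x y = (m : ℝ)

/-- `P` is a subroutine that replaces linearly independent vectors `b₁, …, b_k` (in `Bas`) by a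
basis of the lattice generated by `b₁, …, b_k, v` (`v` in `Vec`), whenever that
lattice is integral. It changes nothing but `k`, `Bas` and its own workspace. -/
def ConstructsBasis (P : Prog) : Prop :=
  ∀ (n k : ℕ) (σ : Memory), σ 0 N = n → σ 0 K = k →
    LinearIndependent ℝ (fun i : Fin k => vecAt σ Bas n i) →
    IsIntegral (Submodule.span ℤ
      (insert (vecAt σ Vec n 0) (Set.range fun i : Fin k => vecAt σ Bas n i))) →
    ∃ (t : ℕ) (τ : Memory) (l : ℕ), Exec P σ t τ ∧
      τ 0 K = l ∧
      LinearIndependent ℝ (fun i : Fin l => vecAt τ Bas n i) ∧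
      Submodule.span ℤ (Set.range fun i : Fin l => vecAt τ Bas n i) =
        Submodule.span ℤ
          (insert (vecAt σ Vec n 0) (Set.range fun i : Fin k => vecAt σ Bas n i)) ∧
      ∀ a m : ℕ, a < 6 → a ≠ Bas → ¬ (a = 0 ∧ m = K) → τ a m = σ a m

/-- `σ` holds the input `n`, `s`, `v₁, …, v_s`; all other cells are arbitrary. -/
def IsInput {n s : ℕ} (v : Fin s → EuclideanSpace ℝ (Fin n)) (σ : Memory) : Prop :=
  σ 0 N = n ∧ σ 0 S = s ∧ ∀ i : Fin s, vecAt σ Gens n i = v i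

/-- `τ` holds a `ℤ`-basis of `L`, consisting of `n` vectors. -/
def IsOutput {n : ℕ} (L : Submodule ℤ (EuclideanSpace ℝ (Fin n))) (τ : Memory) : Prop :=
  τ 0 K = n ∧ ∃ b : Module.Basis (Fin n) ℤ L, ∀ i : Fin n,
    (b i : EuclideanSpace ℝ (Fin n)) = vecAt τ Bas n i

end RealRam

namespace RealRam

/-! ### Total correctness with a time bound -/

/-! The subroutine is a Euclidean algorithm controlled by the Gram determinant. Let `v` be the
vector to be inserted into independent `b₁, …, b_k`. If `v` lies outside their real span, it is
appended, and the Gram determinant grows by a factor of at most `‖v‖²` (`gramDet_succ_le`). If `v`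
lies in the real span and has a non-integral coordinate `x_p`, let `z` be the integer nearest to
`x_p`; then `b_p` is replaced by `v - z b_p`, and the old `b_p` becomes the vector to be inserted.
This exchange preserves the generated lattice (`span_insert_update`) and multiplies the Gram
determinant by `(x_p - z)² ≤ 1/4` (`gramDet_update`). If all coordinates are integral, `v` is
redundant. In an integral lattice the Gram determinant of independent vectors is a positive integer
(`one_le_gramDet`), so the exchanges must stop.

The same determinant is a potential for the whole run. After `k` appended vectors and `m` exchanges,
`gramDet * 4 ^ m ≤ B ^ (2 k)` (`SieveInv`), so at the end `4 ^ m ≤ B ^ (2 n)`. A generator that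
survives the sieve causes at least one append or exchange. Hence the cubic work is done `O(n + m)`
times, while fetching and testing cost `O(n²)` per generator. The resulting `O(n³ (n + m) + s n²)`
is smaller than the claimed bound (`operations_le`).

The remainder is program verification. `Runs` is a total-correctness triple with a time bound.
`Clears` records all that is needed about the matrix `A`: it is injective and sends `b_i` to the
`i`-th unit vector. Renaming arrays lets the subroutine reuse the pieces of the main program on
private memory. -/

theorem write_apply (σ : Memory) (a m : ℕ) (x : ℝ) (a' m' : ℕ) :
    write σ a m x a' m' = if a' = a ∧ m' = m then x else σ a' m' := by
  by_cases ha : a' = a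
  · subst ha
    by_cases hm : m' = m
    · subst hm; simp [write]
    · simp [write, hm]
  · simp [write, ha]

/-- A syntactic upper bound for the cells that a program may change. -/
def Prog.writes : Prog → ℕ → ℕ → Bool
  | .skip, _, _ => false
  | .assign a m _, a', m' =>
      decide (a' = a) && (match m with
        | .lit z => decide (m' = z.toNat)
        | _ => true)
  | .seq P Q, a, m => P.writes a m || Q.writes a m
  | .branch _ P Q, a, m => P.writes a m || Q.writes a m
  | .loop _ P, a, m => P.writes a m

/-- For a concrete program and array the value of `writes` reduces by computation, so later claims
that a cell is unchanged mostly need only `rfl` as premise. -/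
theorem Exec.frame {P : Prog} {σ τ : Memory} {t : ℕ} (h : Exec P σ t τ) {a m : ℕ}
    (hw : P.writes a m = false) : τ a m = σ a m := by
  induction h with
  | skip => rfl
  | assign a' m' e σ =>
    rw [write_apply, if_neg]
    rintro ⟨rfl, rfl⟩
    cases m' with
    | lit z =>
      have h : ⌊(z : ℝ)⌋₊ = z.toNat := by rw [← Int.floor_toNat, Int.floor_intCast]
      simp [Prog.writes, Expr.eval, h] at hw
    | _ => simp [Prog.writes] at hw
  | seq P Q σ τ υ t u _ _ ih₁ ih₂ =>
    simp only [Prog.writes, Bool.or_eq_false_iff] at hw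
    rw [ih₂ hw.2, ih₁ hw.1]
  | branch_true b P Q σ τ t _ _ ih =>
    simp only [Prog.writes, Bool.or_eq_false_iff] at hw
    exact ih hw.1
  | branch_false b P Q σ τ t _ _ ih =>
    simp only [Prog.writes, Bool.or_eq_false_iff] at hw
    exact ih hw.2
  | loop_stop => rfl
  | loop_step b P σ τ υ t u _ _ _ ih₁ ih₂ => rw [ih₂ hw, ih₁ hw]

/-- Started in `σ`, the program `P` halts after at most `c` operations in a memory
satisfying `Q`. -/
def Runs (P : Prog) (σ : Memory) (c : ℕ) (Q : Memory → Prop) : Prop :=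
  ∃ t τ, Exec P σ t τ ∧ t ≤ c ∧ Q τ

/-- The frame of `P` is passed to the new postcondition, so specifications need only describe the
cells that change. -/
theorem Runs.mono {P : Prog} {σ : Memory} {c c' : ℕ} {Q Q' : Memory → Prop} (h : Runs P σ c Q)
    (hc : c ≤ c')
    (hQ : ∀ τ, (∀ a m, P.writes a m = false → τ a m = σ a m) → Q τ → Q' τ) :
    Runs P σ c' Q' := by
  obtain ⟨t, τ, he, ht, hq⟩ := h
  exact ⟨t, τ, he, ht.trans hc, hQ τ (fun a m hw => he.frame hw) hq⟩

theorem Runs.skip {σ : Memory} {Q : Memory → Prop} (h : Q σ) : Runs .skip σ 0 Q :=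
  ⟨0, σ, .skip σ, le_rfl, h⟩

theorem Runs.assign {a : ℕ} {m e : Expr} {σ : Memory} {Q : Memory → Prop}
    (h : Q (write σ a ⌊m.eval σ⌋₊ (e.eval σ))) :
    Runs (.assign a m e) σ (m.cost + e.cost + 1) Q :=
  ⟨_, _, .assign a m e σ, le_rfl, h⟩

theorem Runs.setVar {x : ℕ} {e : Expr} {σ : Memory} {Q : Memory → Prop}
    (h : Q (write σ 0 x (e.eval σ))) :
    Runs (setVar x e) σ (e.cost + 2) Q := by
  refine ⟨_, _, .assign 0 _ e σ, ?_, ?_⟩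
  · simp [Expr.cost]; omega
  · simpa [Expr.eval] using h

/-- Continuation style: the postcondition of the first program is that the second one runs. Proofs
thus follow the execution forwards. -/
theorem Runs.seq {P P' : Prog} {σ : Memory} {c c' : ℕ} {Q : Memory → Prop}
    (h : Runs P σ c fun τ => Runs P' τ c' Q) : Runs (.seq P P') σ (c + c') Q := by
  obtain ⟨t, τ, he, ht, u, υ, he', hu, hq⟩ := h
  exact ⟨_, _, .seq _ _ _ _ _ _ _ he he', add_le_add ht hu, hq⟩

theorem Runs.block_nil {σ : Memory} {Q : Memory → Prop} (h : Q σ) : Runs (block []) σ 0 Q :=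
  Runs.skip h

theorem Runs.block_cons {P : Prog} {l : List Prog} {σ : Memory} {c c' : ℕ} {Q : Memory → Prop}
    (h : Runs P σ c fun τ => Runs (block l) τ c' Q) : Runs (block (P :: l)) σ (c + c') Q :=
  Runs.seq h

theorem Runs.branch {b : Test} {P P' : Prog} {σ : Memory} {c : ℕ} {Q : Memory → Prop}
    (h : b.Holds σ → Runs P σ c Q) (h' : ¬ b.Holds σ → Runs P' σ c Q) :
    Runs (.branch b P P') σ (b.cost + c) Q := by
  by_cases hb : b.Holds σ
  · obtain ⟨t, τ, he, ht, hq⟩ := h hb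
    exact ⟨_, _, .branch_true _ _ _ _ _ _ hb he, by omega, hq⟩
  · obtain ⟨t, τ, he, ht, hq⟩ := h' hb
    exact ⟨_, _, .branch_false _ _ _ _ _ _ hb he, by omega, hq⟩

theorem Runs.loop_stop {b : Test} {P : Prog} {σ : Memory} {Q : Memory → Prop}
    (hb : ¬ b.Holds σ) (h : Q σ) : Runs (.loop b P) σ b.cost Q :=
  ⟨_, _, Exec.loop_stop _ _ _ hb, le_rfl, h⟩

theorem Runs.loop_step {b : Test} {P : Prog} {σ : Memory} {c c' : ℕ} {Q : Memory → Prop}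
    (hb : b.Holds σ) (h : Runs P σ c fun τ => Runs (.loop b P) τ c' Q) :
    Runs (.loop b P) σ (b.cost + c + c') Q := by
  obtain ⟨t, τ, he, ht, u, υ, he', hu, hq⟩ := h
  exact ⟨_, _, .loop_step _ _ _ _ _ _ _ hb he he', by omega, hq⟩

@[simp] theorem eval_var (σ : Memory) (x : ℕ) : (var x).eval σ = σ 0 x := by
  simp [var, Expr.eval]

@[simp] theorem cost_var (x : ℕ) : (var x).cost = 2 := rfl

@[simp] theorem cost_idx (i j : ℕ) : (idx i j).cost = 8 := rfl

theorem floor_idx (i n j : ℕ) : ⌊(i : ℝ) * n + j⌋₊ = i * n + j := by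
  exact_mod_cast Nat.floor_natCast (R := ℝ) (i * n + j)

theorem eval_idx {σ : Memory} {i j n i' j' : ℕ} (hn : σ 0 N = n) (hi : σ 0 i = i')
    (hj : σ 0 j = j') : ⌊(idx i j).eval σ⌋₊ = i' * n + j' := by
  simp [idx, Expr.eval, hn, hi, hj, floor_idx]

/-- The invariant rule for bounded loops whose iterations may differ in cost; the second argument
of the invariant is the time spent by the previous iterations. -/
theorem Runs.forLoop_amortized {x y : ℕ} {P : Prog} {σ : Memory} {n : ℕ}
    (inv : ℕ → ℕ → Memory → Prop)
    (hy : σ 0 y = n) (hyx : y ≠ x) (hPx : P.writes 0 x = false) (hPy : P.writes 0 y = false)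
    (h0 : inv 0 0 σ) (hw : ∀ i u τ z, inv i u τ → inv i u (write τ 0 x z))
    (hstep : ∀ i < n, ∀ u, ∀ τ : Memory,
      (∀ a m, P.writes a m = false → ¬ (a = 0 ∧ m = x) → τ a m = σ a m) →
      τ 0 x = i → inv i u τ → ∃ t, Runs P τ t (inv (i + 1) (u + t))) :
    ∃ t, Runs (forLoop x (var y) P) σ (t + 11 * (n + 1)) (inv n t) := by
  -- Induction on the number `d` of remaining iterations. Each costs 5 for the test and 6 for the
  -- increment, beyond the body; the lone 5 is the final failing test.
  have key : ∀ d i : ℕ, i + d = n → ∀ u, ∀ τ : Memory,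
      (∀ a m, P.writes a m = false → ¬ (a = 0 ∧ m = x) → τ a m = σ a m) →
      τ 0 x = i → inv i u τ → ∃ t,
      Runs (.loop (.lt (var x) (var y)) (.seq P (RealRam.setVar x (.add (var x) (.lit 1)))))
        τ (t + 5 + d * 11) (inv n (u + t)) := by
    intro d
    induction d with
    | zero =>
      intro i hi u τ hfr hx hinv
      obtain rfl : i = n := by omega
      refine ⟨0, (Runs.loop_stop (Q := inv i u) ?_ hinv).mono (by simp [Test.cost])
        fun _ _ h => h⟩
      simp [Test.Holds, hx, hfr 0 y hPy (fun h => hyx h.2), hy]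
    | succ d ih =>
      intro i hi u τ hfr hx hinv
      obtain ⟨t, t', τ', hex, ht, hinv'⟩ := hstep i (by omega) u τ hfr hx hinv
      have hfr' : ∀ a m, P.writes a m = false → τ' a m = τ a m := fun a m h => hex.frame h
      obtain ⟨t₂, h₂⟩ := ih (i + 1) (by omega) (u + t) (write τ' 0 x (i + 1 : ℕ))
        (fun a m hp hne => by rw [write_apply, if_neg hne, hfr' a m hp, hfr a m hp hne])
        (by simp [write_apply]) (hw _ _ _ _ hinv')
      refine ⟨t + t₂, (Runs.loop_step (c := t + 6) (c' := t₂ + 5 + d * 11) ?_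
        (Runs.seq ⟨t', τ', hex, ht, Runs.setVar (e := .add (var x) (.lit 1)) ?_⟩)).mono ?_
        fun _ _ h => h⟩
      · simp only [Test.Holds, eval_var, hx, hfr 0 y hPy (fun h => hyx h.2), hy]
        exact_mod_cast (by omega : i < n)
      · rw [← add_assoc]
        convert h₂ using 2
        simp [Expr.eval, hfr' 0 x hPx, hx]
      · simp [Test.cost]; ring_nf; omega
  obtain ⟨t, ht⟩ := key n 0 (by omega) 0 (write σ 0 x 0)
    (fun a m _ hne => by rw [write_apply, if_neg hne]) (by simp [write_apply]) (hw _ _ _ _ h0)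
  rw [zero_add] at ht
  refine ⟨t, Runs.mono (Runs.block_cons (c := 3) (c' := t + 5 + n * 11 + 0) (Q := inv n t)
    (Runs.setVar (e := .lit 0) ?_)) (by omega) fun _ _ h => h⟩
  refine Runs.block_cons (c' := 0) (Runs.mono (Q := inv n t) ?_ le_rfl
    fun τ _ h => Runs.block_nil h)
  simpa [Expr.eval] using ht

/-- The invariant rule for bounded loops. -/
theorem Runs.forLoop {x y : ℕ} {P : Prog} {σ : Memory} {n c : ℕ} (inv : ℕ → Memory → Prop)
    (hy : σ 0 y = n) (hyx : y ≠ x) (hPx : P.writes 0 x = false) (hPy : P.writes 0 y = false)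
    (h0 : inv 0 σ) (hw : ∀ i τ z, inv i τ → inv i (write τ 0 x z))
    (hstep : ∀ i < n, ∀ τ : Memory,
      (∀ a m, P.writes a m = false → ¬ (a = 0 ∧ m = x) → τ a m = σ a m) →
      τ 0 x = i → inv i τ → Runs P τ c (inv (i + 1))) :
    Runs (forLoop x (var y) P) σ ((n + 1) * (c + 11)) (inv n) := by
  obtain ⟨t, t', τ, he, ht, hinv, htc⟩ := Runs.forLoop_amortized
    (fun i u τ => inv i τ ∧ u ≤ i * c) hy hyx hPx hPy ⟨h0, Nat.zero_le _⟩
    (fun i u τ z h => ⟨hw i τ z h.1, h.2⟩) fun i hi u τ hfr hx h =>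
      ⟨c, (hstep i hi τ hfr hx h.1).mono le_rfl fun τ' _ h' => ⟨h', by linarith [h.2]⟩⟩
  exact ⟨t', τ, he, by nlinarith, hinv⟩

/-! ### Renaming arrays -/

/-- The subroutine must leave the caller's scalars (except `k`), `Vec`, `Mat` and `Out` intact, but
it is built from programs that overwrite them. Renaming moves those programs to fresh arrays. -/
def Expr.rename (ρ : ℕ → ℕ) : Expr → Expr
  | .lit z => .lit z
  | .get a m => .get (ρ a) (m.rename ρ)
  | .add x y => .add (x.rename ρ) (y.rename ρ)
  | .sub x y => .sub (x.rename ρ) (y.rename ρ)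
  | .mul x y => .mul (x.rename ρ) (y.rename ρ)
  | .div x y => .div (x.rename ρ) (y.rename ρ)
  | .floor x => .floor (x.rename ρ)

def Test.rename (ρ : ℕ → ℕ) : Test → Test
  | .lt x y => .lt (x.rename ρ) (y.rename ρ)
  | .eq x y => .eq (x.rename ρ) (y.rename ρ)

/-- The program `P` working on array `ρ a` in place of array `a`. -/
def Prog.rename (ρ : ℕ → ℕ) : Prog → Prog
  | .skip => .skip
  | .assign a m e => .assign (ρ a) (m.rename ρ) (e.rename ρ)
  | .seq P Q => .seq (P.rename ρ) (Q.rename ρ)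
  | .branch b P Q => .branch (b.rename ρ) (P.rename ρ) (Q.rename ρ)
  | .loop b P => .loop (b.rename ρ) (P.rename ρ)

theorem Expr.eval_rename (ρ : ℕ → ℕ) (σ : Memory) (e : Expr) :
    (e.rename ρ).eval σ = e.eval fun a => σ (ρ a) := by
  induction e <;> simp_all [Expr.rename, Expr.eval]

theorem Expr.cost_rename (ρ : ℕ → ℕ) (e : Expr) : (e.rename ρ).cost = e.cost := by
  induction e <;> simp_all [Expr.rename, Expr.cost]

theorem Test.holds_rename (ρ : ℕ → ℕ) (σ : Memory) (b : Test) :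
    (b.rename ρ).Holds σ ↔ b.Holds fun a => σ (ρ a) := by
  cases b <;> simp [Test.rename, Test.Holds, Expr.eval_rename]

theorem Test.cost_rename (ρ : ℕ → ℕ) (b : Test) : (b.rename ρ).cost = b.cost := by
  cases b <;> simp [Test.rename, Test.cost, Expr.cost_rename]

/-- By injectivity of `ρ`, a write to array `ρ a` is seen through `ρ` as a write to `a` alone; so
the renamed run is step by step the original run, at the same cost. -/
theorem Exec.rename {ρ : ℕ → ℕ} (hρ : Function.Injective ρ) {P : Prog} {σ τ : Memory} {t : ℕ}
    (h : Exec P σ t τ) (σ' : Memory) (hσ : σ = fun a => σ' (ρ a)) :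
    ∃ τ', Exec (P.rename ρ) σ' t τ' ∧ (τ = fun a => τ' (ρ a)) ∧
      ∀ a ∉ Set.range ρ, τ' a = σ' a := by
  induction h generalizing σ' with
  | skip => exact ⟨σ', .skip _, hσ, fun _ _ => rfl⟩
  | assign a m e σ =>
    subst hσ
    have h := Exec.assign (ρ a) (m.rename ρ) (e.rename ρ) σ'
    rw [Expr.cost_rename, Expr.cost_rename, Expr.eval_rename, Expr.eval_rename] at h
    refine ⟨_, h, ?_, ?_⟩
    · funext a' m'
      simp [write_apply, hρ.eq_iff]
    · intro a' ha'
      funext m'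
      rw [write_apply, if_neg]
      rintro ⟨rfl, -⟩
      exact ha' ⟨a, rfl⟩
  | seq P Q σ τ υ t u _ _ ih₁ ih₂ =>
    obtain ⟨τ', h₁, e₁, f₁⟩ := ih₁ σ' hσ
    obtain ⟨υ', h₂, e₂, f₂⟩ := ih₂ τ' e₁
    exact ⟨υ', .seq _ _ _ _ _ _ _ h₁ h₂, e₂, fun a ha => (f₂ a ha).trans (f₁ a ha)⟩
  | branch_true b P Q σ τ t hb _ ih =>
    obtain ⟨τ', h₁, e₁, f₁⟩ := ih σ' hσ
    refine ⟨τ', ?_, e₁, f₁⟩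
    rw [← Test.cost_rename ρ b]
    exact .branch_true _ _ _ _ _ _ ((Test.holds_rename ρ σ' b).2 (hσ ▸ hb)) h₁
  | branch_false b P Q σ τ t hb _ ih =>
    obtain ⟨τ', h₁, e₁, f₁⟩ := ih σ' hσ
    refine ⟨τ', ?_, e₁, f₁⟩
    rw [← Test.cost_rename ρ b]
    exact .branch_false _ _ _ _ _ _ (fun h => hb (hσ ▸ (Test.holds_rename ρ σ' b).1 h)) h₁
  | loop_stop b P σ hb =>
    refine ⟨σ', ?_, hσ, fun _ _ => rfl⟩
    rw [← Test.cost_rename ρ b]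
    exact Exec.loop_stop _ _ _ fun h => hb (hσ ▸ (Test.holds_rename ρ σ' b).1 h)
  | loop_step b P σ τ υ t u hb _ _ ih₁ ih₂ =>
    obtain ⟨τ', h₁, e₁, f₁⟩ := ih₁ σ' hσ
    obtain ⟨υ', h₂, e₂, f₂⟩ := ih₂ τ' e₁
    refine ⟨υ', ?_, e₂, fun a ha => (f₂ a ha).trans (f₁ a ha)⟩
    rw [← Test.cost_rename ρ b]
    exact .loop_step _ _ _ _ _ _ _ ((Test.holds_rename ρ σ' b).2 (hσ ▸ hb)) h₁ h₂

theorem Runs.rename {ρ : ℕ → ℕ} (hρ : Function.Injective ρ) {P : Prog} {σ : Memory} {c : ℕ}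
    {Q : Memory → Prop} (h : Runs P (fun a => σ (ρ a)) c Q) :
    Runs (P.rename ρ) σ c fun τ => Q (fun a => τ (ρ a)) ∧ ∀ a ∉ Set.range ρ, τ a = σ a := by
  obtain ⟨t, τ, he, ht, hq⟩ := h
  obtain ⟨τ', he', e', f'⟩ := he.rename hρ σ rfl
  exact ⟨t, τ', he', ht, e' ▸ hq, f'⟩

open Finset

theorem Runs.weaken {P : Prog} {σ : Memory} {c c' : ℕ} {Q : Memory → Prop} (h : Runs P σ c Q)
    (hc : c ≤ c') : Runs P σ c' Q :=
  h.mono hc fun _ _ h => h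

/-! ### The components of the algorithm -/

theorem mulVec_runs {σ : Memory} {n : ℕ} (hn : σ 0 N = n) :
    Runs mulVec σ (100 * (n + 1) ^ 2) fun τ =>
      ∀ r < n, τ Out r = ∑ j ∈ range n, σ Mat (r * n + j) * σ Vec j := by
  refine (Runs.forLoop (c := 50 * (n + 1))
    (fun i τ => ∀ r < i, τ Out r = ∑ j ∈ range n, σ Mat (r * n + j) * σ Vec j)
    hn (by decide) rfl rfl (by simp) ?_ ?_).weaken (by nlinarith)
  · intro i τ z h r hr
    simpa [write_apply, Out] using h r hr
  · intro i hi τ hfr hR hinv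
    refine Runs.weaken (Runs.block_cons (Runs.setVar (Runs.block_cons (Runs.mono
      (Runs.forLoop (c := 18) (fun l τ' => τ' 0 Tmp = ∑ j ∈ range l, σ Mat (i * n + j) * σ Vec j)
      (n := n) ?_ (by decide) rfl rfl ?_ ?_ ?_) le_rfl ?_)))) (c := 3 + ((n + 1) * (18 + 11) + 7)) ?_
    · rw [write_apply, if_neg (by decide), hfr 0 N rfl (by decide), hn]
    · simp [write_apply, Expr.eval]
    · intro l τ' z h
      simpa [write_apply, Tmp, J] using h
    · intro l hl τ' hfr' hJ h
      refine Runs.weaken (Runs.setVar ?_) (by simp [Expr.cost])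
      have e1 : τ' 0 N = n := by
        rw [hfr' 0 N rfl (by decide), write_apply, if_neg (by decide), hfr 0 N rfl (by decide), hn]
      have e2 : τ' 0 R = i := by
        rw [hfr' 0 R rfl (by decide), write_apply, if_neg (by decide), hR]
      have e3 : ∀ m, τ' Mat m = σ Mat m := fun m => by
        rw [hfr' Mat m rfl (by simp [Mat]), write_apply, if_neg (by simp [Mat]),
          hfr Mat m rfl (by simp [Mat])]
      have e4 : ∀ m, τ' Vec m = σ Vec m := fun m => by
        rw [hfr' Vec m rfl (by simp [Vec]), write_apply, if_neg (by simp [Vec]),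
          hfr Vec m rfl (by simp [Vec])]
      rw [write_apply, if_pos ⟨rfl, rfl⟩, sum_range_succ, ← h]
      simp only [Expr.eval, eval_var, eval_idx e1 e2 hJ, hJ, Nat.floor_natCast, e3, e4]
    · intro τ' hfr' h
      refine Runs.weaken (Runs.block_cons (c' := 0) (Runs.assign (Runs.block_nil ?_)))
        (by simp)
      have e2 : τ' 0 R = i := by
        rw [hfr' 0 R rfl, write_apply, if_neg (by decide), hR]
      intro r hr
      simp only [eval_var, e2, Nat.floor_natCast, write_apply]
      split_ifs with hc
      · rw [h, hc.2]
      · have : r < i := by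
          simp only [true_and] at hc; omega
        rw [hfr' Out r rfl, write_apply, if_neg (by simp [Out]), hinv r this]
    · omega

theorem fetch_runs {σ : Memory} {a i i' n : ℕ} (hn : σ 0 N = n) (hi : σ 0 i = i') (hiJ : i ≠ J)
    (ha : a ≠ Vec) (ha' : a ≠ 0) :
    Runs (fetch a i) σ (30 * (n + 1)) fun τ => ∀ j < n, τ Vec j = σ a (i' * n + j) := by
  refine (Runs.forLoop (c := 12) (fun l τ => ∀ j < l, τ Vec j = σ a (i' * n + j))
    hn (by decide) rfl rfl (by simp) ?_ ?_).weaken (by omega)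
  · intro i τ z h r hr
    simpa [write_apply, Vec] using h r hr
  · intro l hl τ hfr hJ h
    refine (Runs.assign ?_).weaken (by simp [Expr.cost])
    have e1 : τ 0 N = n := by rw [hfr 0 N rfl (by decide), hn]
    have e2 : τ 0 i = i' := by rw [hfr 0 i rfl (by simp [hiJ]), hi]
    have e3 : ∀ m, τ a m = σ a m := fun m => hfr a m (by simp [Prog.writes, ha]) (by simp [ha'])
    intro j hj
    simp only [eval_var, hJ, Nat.floor_natCast, write_apply, Expr.eval, eval_idx e1 e2 hJ, e3]
    split_ifs with hc
    · rw [hc.2]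
    · exact h j (by simp only [true_and] at hc; omega)

theorem mul_add_inj {n m m' : ℕ} (hm : m < n) (hm' : m' < n) (r r' : ℕ) :
    r * n + m = r' * n + m' ↔ r = r' ∧ m = m' := by
  constructor
  · intro h
    have h1 : r = r' := by
      have e1 : (r * n + m) / n = r := by
        rw [mul_comm, Nat.mul_add_div (by omega), Nat.div_eq_of_lt hm, add_zero]
      have e2 : (r' * n + m') / n = r' := by
        rw [mul_comm, Nat.mul_add_div (by omega), Nat.div_eq_of_lt hm', add_zero]
      rw [← e1, ← e2, h]
    subst h1
    exact ⟨rfl, by omega⟩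
  · rintro ⟨rfl, rfl⟩; rfl

theorem setOne_runs {σ : Memory} {n : ℕ} (hn : σ 0 N = n) :
    Runs setOne σ (100 * (n + 1) ^ 2) fun τ =>
      ∀ r < n, ∀ m < n, τ Mat (r * n + m) = if r = m then 1 else 0 := by
  refine (Runs.forLoop (c := 40 * (n + 1))
    (fun i τ => ∀ r < i, ∀ m < n, τ Mat (r * n + m) = if r = m then 1 else 0)
    hn (by decide) rfl rfl (by simp) ?_ ?_).weaken (by nlinarith)
  · intro i τ z h r hr m hm
    simpa [write_apply, Mat] using h r hr m hm
  · intro i hi τ hfr hR hinv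
    refine Runs.mono (Runs.forLoop (c := 15)
      (fun l τ' => ∀ r ≤ i, ∀ m < n, (r = i → m < l) →
        τ' Mat (r * n + m) = if r = m then 1 else 0)
      (n := n) ?_ (by decide) rfl rfl ?_ ?_ ?_) (by omega) ?_
    · rw [hfr 0 N rfl (by decide), hn]
    · intro r hr m hm h
      exact hinv r (by omega) m hm
    · intro l τ' z h r hr m hm hl
      simpa [write_apply, Mat] using h r hr m hm hl
    · intro l hl τ' hfr' hJ h
      have e1 : τ' 0 N = n := by rw [hfr' 0 N rfl (by decide), hfr 0 N rfl (by decide), hn]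
      have e2 : τ' 0 R = i := by rw [hfr' 0 R rfl (by decide), hR]
      refine Runs.weaken (Runs.branch (c := 10) ?_ ?_) (by simp [Test.cost])
      · intro hb
        simp only [Test.Holds, eval_var, e2, hJ, Nat.cast_inj] at hb
        refine (Runs.assign ?_).weaken (by simp [Expr.cost])
        intro r hr m hm hrm
        simp only [write_apply, eval_idx e1 e2 hJ, mul_add_inj hm hl, true_and, Expr.eval]
        split_ifs with h1 h2 h2
        · simp
        · omega
        · rw [h r hr m hm (by omega), if_pos h2]
        · rw [h r hr m hm (by omega), if_neg h2]
      · intro hb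
        simp only [Test.Holds, eval_var, e2, hJ, Nat.cast_inj] at hb
        refine (Runs.assign ?_).weaken (by simp [Expr.cost])
        intro r hr m hm hrm
        simp only [write_apply, eval_idx e1 e2 hJ, mul_add_inj hm hl, true_and, Expr.eval]
        split_ifs with h1 h2 h2
        · omega
        · simp
        · rw [h r hr m hm (by omega), if_pos h2]
        · rw [h r hr m hm (by omega), if_neg h2]
    · intro τ' _ h r hr m hm
      exact h r (by omega) m hm fun _ => hm

/-- Execute `P` for each index `r < n` at which the entry of `Out` is not an integer (for `r < k`)
or not zero (for `k ≤ r`). -/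
def scan (P : Prog) : Prog :=
  forLoop R (var N)
    (.branch (.lt (var R) (var K))
      (.branch (.eq (.floor (.get Out (var R))) (.get Out (var R))) .skip P)
      (.branch (.eq (.get Out (var R)) (.lit 0)) .skip P))

/-- The `r`-th coordinate excludes membership in the lattice spanned by `k` basis vectors. -/
def Bad (k r : ℕ) (x : ℝ) : Prop :=
  if r < k then ∀ z : ℤ, x ≠ z else x ≠ 0

/-- Serves both `sieveTest` and `findBad`, which are scans with different bodies `P`. As `P` does
not touch `Out`, badness may be judged in the initial memory. -/
theorem scan_runs {P : Prog} {σ : Memory} {n k c : ℕ} (inv : ℕ → Memory → Prop)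
    (hn : σ 0 N = n) (hk : σ 0 K = k) (hP : P.writes 0 R = false) (hPN : P.writes 0 N = false)
    (hPK : P.writes 0 K = false) (hPO : ∀ m, P.writes Out m = false)
    (h0 : inv 0 σ) (hw : ∀ i τ z, inv i τ → inv i (write τ 0 R z))
    (hgood : ∀ i < n, ∀ τ : Memory, ¬ Bad k i (σ Out i) → inv i τ → inv (i + 1) τ)
    (hbad : ∀ i < n, ∀ τ : Memory, τ 0 R = i → Bad k i (σ Out i) → inv i τ →
      Runs P τ c (inv (i + 1))) :
    Runs (scan P) σ ((n + 1) * (c + 25)) (inv n) := by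
  have hwr : ∀ a m, P.writes a m = false → (Prog.branch (.lt (var R) (var K))
      (.branch (.eq (.floor (.get Out (var R))) (.get Out (var R))) .skip P)
      (.branch (.eq (.get Out (var R)) (.lit 0)) .skip P)).writes a m = false := by
    intro a m h; simp [Prog.writes, h]
  refine (Runs.forLoop (c := c + 14) inv hn (by decide) (hwr _ _ hP) (hwr _ _ hPN) h0 hw
    ?_).weaken (by nlinarith)
  intro i hi τ hfr hR hinv
  have e1 : τ 0 K = k := by rw [hfr 0 K (hwr _ _ hPK) (by decide), hk]
  have e2 : τ Out i = σ Out i := hfr Out i (hwr _ _ (hPO i)) (by simp [Out])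
  refine (Runs.branch (c := c + 9) ?_ ?_).weaken (by simp [Test.cost]; omega)
  · intro hb
    simp only [Test.Holds, eval_var, e1, hR, Nat.cast_lt] at hb
    refine (Runs.branch (c := c) ?_ ?_).weaken (by simp [Test.cost, Expr.cost]; omega)
    · intro hf
      simp only [Test.Holds, Expr.eval, eval_var, hR, Nat.floor_natCast, e2] at hf
      refine (Runs.skip (hgood i hi τ ?_ hinv)).weaken (Nat.zero_le _)
      rw [Bad, if_pos hb]
      exact fun h => h _ hf.symm
    · intro hf
      simp only [Test.Holds, Expr.eval, eval_var, hR, Nat.floor_natCast, e2] at hf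
      refine hbad i hi τ hR ?_ hinv
      rw [Bad, if_pos hb]
      rintro z hz
      exact hf (by rw [hz, Int.floor_intCast])
  · intro hb
    simp only [Test.Holds, eval_var, e1, hR, Nat.cast_lt] at hb
    refine (Runs.branch (c := c) ?_ ?_).weaken (by simp [Test.cost, Expr.cost]; omega)
    · intro hf
      simp only [Test.Holds, Expr.eval, eval_var, hR, Nat.floor_natCast, e2, Int.cast_zero] at hf
      refine (Runs.skip (hgood i hi τ ?_ hinv)).weaken (Nat.zero_le _)
      rw [Bad, if_neg hb]
      exact fun h => h hf
    · intro hf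
      simp only [Test.Holds, Expr.eval, eval_var, hR, Nat.floor_natCast, e2, Int.cast_zero] at hf
      refine hbad i hi τ hR ?_ hinv
      rwa [Bad, if_neg hb]

theorem sieveTest_runs {σ : Memory} {n k : ℕ} (hn : σ 0 N = n) (hk : σ 0 K = k) :
    Runs sieveTest σ (200 * (n + 1) ^ 2) fun τ =>
      (τ 0 Flag = 0 ↔
        ∃ r < n, Bad k r (∑ j ∈ range n, σ Mat (r * n + j) * σ Vec j)) := by
  refine Runs.weaken (c := 100 * (n + 1) ^ 2 + (3 + ((n + 1) * (3 + 25) + 0)))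
    (Runs.block_cons ((mulVec_runs hn).mono le_rfl fun τ hfr h =>
      Runs.block_cons (Runs.weaken (Runs.setVar (Runs.block_cons ((scan_runs (n := n) (k := k)
        (P := setVar Flag (.lit 0)) (c := 3)
        (fun i τ' => τ' 0 Flag = 0 ↔ ∃ r < i, Bad k r (τ Out r)) ?_ ?_ rfl rfl rfl
        (fun _ => rfl) ?_ ?_ ?_ ?_).mono le_rfl fun τ' hfr' h' => Runs.block_nil ?_))) le_rfl)))
    (by ring_nf; omega)
  · rw [write_apply, if_neg (by decide), hfr 0 N rfl, hn]
  · rw [write_apply, if_neg (by decide), hfr 0 K rfl, hk]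
  · simp [write_apply, Expr.eval]
  · intro i τ' z h
    simpa [write_apply, Flag, R] using h
  · intro i hi τ' hb h
    rw [write_apply, if_neg (by simp [Out])] at hb
    rw [h]
    refine ⟨fun ⟨r, hr, hb⟩ => ⟨r, by omega, hb⟩, fun ⟨r, hr, hb'⟩ => ⟨r, ?_, hb'⟩⟩
    by_contra hlt
    obtain rfl : r = i := by omega
    exact hb hb'
  · intro i hi τ' hR hb h
    rw [write_apply, if_neg (by simp [Out])] at hb
    refine (Runs.setVar ?_).weaken (by simp [Expr.cost])
    simp only [write_apply, Expr.eval, and_self, if_true, Int.cast_zero, true_iff]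
    exact ⟨i, by omega, hb⟩
  · rw [h']
    exact exists_congr fun r => and_congr_right fun hr => by rw [h r hr]

/-- Set `Piv` to the last index at which the coordinates of `v` are bad, and to `n` if there is
no such index. -/
def findBad : Prog := block [mulVec, setVar Piv (var N), scan (setVar Piv (var R))]

/-- Taking the last bad index matters: an index at least `k` wins over those below `k`, so comparing
it with `k` later decides whether the vector lies in the real span of the basis. The value `n`
encodes that no index is bad. -/
theorem findBad_runs {σ : Memory} {n k : ℕ} (hn : σ 0 N = n) (hk : σ 0 K = k) :
    Runs findBad σ (200 * (n + 1) ^ 2) fun τ =>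
      (∀ r < n, τ Out r = ∑ j ∈ range n, σ Mat (r * n + j) * σ Vec j) ∧
      ((τ 0 Piv = n ∧ ∀ r < n, ¬ Bad k r (τ Out r)) ∨
        ∃ p < n, τ 0 Piv = p ∧ Bad k p (τ Out p) ∧ ∀ r < n, p < r → ¬ Bad k r (τ Out r)) := by
  refine Runs.weaken (c := 100 * (n + 1) ^ 2 + (4 + ((n + 1) * (4 + 25) + 0)))
    (Runs.block_cons ((mulVec_runs hn).mono le_rfl fun τ hfr h =>
      Runs.block_cons (Runs.weaken (Runs.setVar (Runs.block_cons ((scan_runs (n := n) (k := k)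
        (P := setVar Piv (var R)) (c := 4)
        (fun i τ' => ((τ' 0 Piv = n ∧ ∀ r < i, ¬ Bad k r (τ Out r)) ∨
          ∃ p < i, τ' 0 Piv = p ∧ Bad k p (τ Out p) ∧ ∀ r < i, p < r → ¬ Bad k r (τ Out r)))
        ?_ ?_ rfl rfl rfl
        (fun _ => rfl) ?_ ?_ ?_ ?_).mono le_rfl fun τ' hfr' h' => Runs.block_nil ?_))) le_rfl)))
    (by ring_nf; omega)
  · rw [write_apply, if_neg (by decide), hfr 0 N rfl, hn]
  · rw [write_apply, if_neg (by decide), hfr 0 K rfl, hk]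
  · left
    simp [write_apply, hfr 0 N rfl, hn]
  · intro i τ' z h
    simpa [write_apply, Piv, R] using h
  · intro i hi τ' hb h
    rw [write_apply, if_neg (by simp [Out])] at hb
    have key : ∀ r, r < i + 1 → r < i ∨ r = i := fun r h => by omega
    rcases h with ⟨h1, h2⟩ | ⟨p, hp, h1, h2, h3⟩
    · refine Or.inl ⟨h1, fun r hr => ?_⟩
      rcases key r hr with hr | rfl
      exacts [h2 r hr, hb]
    · refine Or.inr ⟨p, by omega, h1, h2, fun r hr hpr => ?_⟩
      rcases key r hr with hr | rfl
      exacts [h3 r hr hpr, hb]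
  · intro i hi τ' hR hb h
    rw [write_apply, if_neg (by simp [Out])] at hb
    refine (Runs.setVar ?_).weaken (by simp)
    refine Or.inr ⟨i, by omega, ?_, hb, fun r hr hpr => by omega⟩
    simp [write_apply, hR]
  · have hO : ∀ r, τ' Out r = τ Out r := fun r => by
      rw [hfr' Out r rfl, write_apply, if_neg (by simp [Out])]
    simp only [hO]
    exact ⟨h, h'⟩

/-! ### Gaussian elimination, one row operation at a time. -/

def swapRows : Prog :=
  forLoop J (var N) (block
    [setVar Tmp (.get Mat (idx Piv J)),
     .assign Mat (idx Piv J) (.get Mat (idx Col J)),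
     .assign Mat (idx Col J) (var Tmp)])

theorem swapRows_runs {σ : Memory} {n c q : ℕ} (hn : σ 0 N = n) (hc : σ 0 Col = c)
    (hq : σ 0 Piv = q) (hcn : c < n) (hqn : q < n) :
    Runs swapRows σ (100 * (n + 1)) fun τ =>
      ∀ r < n, ∀ m < n, τ Mat (r * n + m) = σ Mat (Equiv.swap c q r * n + m) := by
  refine Runs.mono (Runs.forLoop (c := 60)
    (fun l τ => ∀ r < n, ∀ m < n, τ Mat (r * n + m) =
      if m < l then σ Mat (Equiv.swap c q r * n + m) else σ Mat (r * n + m))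
    hn (by decide) rfl rfl (by simp) ?_ ?_) (by omega) ?_
  · intro i τ z h r hr m hm
    simpa [write_apply, Mat] using h r hr m hm
  · intro l hl τ hfr hJ h
    have e1 : τ 0 N = n := by rw [hfr 0 N rfl (by decide), hn]
    have e2 : τ 0 Col = c := by rw [hfr 0 Col rfl (by decide), hc]
    have e3 : τ 0 Piv = q := by rw [hfr 0 Piv rfl (by decide), hq]
    refine (Runs.block_cons (c' := 18 + 11) (Runs.setVar (Runs.block_cons (c' := 11)
      (Runs.assign (Runs.block_cons (c' := 0) (Runs.assign (Runs.block_nil ?_))))))).weaken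
      (by simp [Expr.cost])
    obtain ⟨τ₁, h1⟩ : ∃ τ₁, τ₁ = write τ 0 Tmp ((Expr.get Mat (idx Piv J)).eval τ) := ⟨_, rfl⟩
    have f1 : τ₁ 0 N = n := by rw [h1, write_apply, if_neg (by decide), e1]
    have f2 : τ₁ 0 Col = c := by rw [h1, write_apply, if_neg (by decide), e2]
    have f3 : τ₁ 0 Piv = q := by rw [h1, write_apply, if_neg (by decide), e3]
    have f4 : τ₁ 0 J = l := by rw [h1, write_apply, if_neg (by decide), hJ]
    have f5 : τ₁ 0 Tmp = τ Mat (q * n + l) := by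
      rw [h1, write_apply, if_pos ⟨rfl, rfl⟩, Expr.eval, eval_idx e1 e3 hJ]
    have f6 : ∀ m, τ₁ Mat m = τ Mat m := fun m => by
      rw [h1, write_apply, if_neg (by simp [Mat])]
    rw [← h1]
    obtain ⟨τ₂, h2⟩ : ∃ τ₂, τ₂ = write τ₁ Mat ⌊(idx Piv J).eval τ₁⌋₊
      ((Expr.get Mat (idx Col J)).eval τ₁) := ⟨_, rfl⟩
    have g : ∀ x, τ₂ 0 x = τ₁ 0 x := fun x => by rw [h2, write_apply, if_neg (by simp [Mat])]
    have g6 : ∀ m, τ₂ Mat m = if m = q * n + l then τ Mat (c * n + l) else τ Mat m := fun m => by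
      rw [h2, write_apply, Expr.eval, eval_idx f1 f3 f4, eval_idx f1 f2 f4, f6, f6]
      simp
    rw [← h2]
    intro r hr m hm
    rw [write_apply, eval_idx ((g _).trans f1) ((g _).trans f2) ((g _).trans f4), eval_var, g,
      f5, g6]
    simp only [mul_add_inj hm hl, true_and]
    by_cases hml : m = l
    · subst hml
      rw [h c hcn m hm, h q hqn m hm, h r hr m hm]
      simp only [and_true, lt_irrefl, if_false, Nat.lt_succ_self, if_true, Equiv.swap_apply_def]
      split_ifs <;> rfl
    · simp only [hml, and_false, if_false]
      rw [h r hr m hm]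
      refine if_congr ?_ rfl rfl
      omega
  · intro τ _ h r hr m hm
    rw [h r hr m hm, if_pos hm]

def scaleRow : Prog :=
  forLoop J (var N) (.assign Mat (idx Col J) (.div (.get Mat (idx Col J)) (var Tmp)))

theorem scaleRow_runs {σ : Memory} {n c : ℕ} (hn : σ 0 N = n) (hc : σ 0 Col = c) :
    Runs scaleRow σ (50 * (n + 1)) fun τ =>
      ∀ r < n, ∀ m < n, τ Mat (r * n + m) =
        if r = c then σ Mat (r * n + m) / σ 0 Tmp else σ Mat (r * n + m) := by
  refine Runs.mono (Runs.forLoop (c := 21)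
    (fun l τ => ∀ r < n, ∀ m < n, τ Mat (r * n + m) =
      if r = c ∧ m < l then σ Mat (r * n + m) / σ 0 Tmp else σ Mat (r * n + m))
    hn (by decide) rfl rfl (by simp) ?_ ?_) (by omega) ?_
  · intro i τ z h r hr m hm
    simpa [write_apply, Mat] using h r hr m hm
  · intro l hl τ hfr hJ h
    have e1 : τ 0 N = n := by rw [hfr 0 N rfl (by decide), hn]
    have e2 : τ 0 Col = c := by rw [hfr 0 Col rfl (by decide), hc]
    have e3 : τ 0 Tmp = σ 0 Tmp := hfr 0 Tmp rfl (by decide)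
    refine (Runs.assign ?_).weaken (by simp [Expr.cost])
    intro r hr m hm
    simp only [Expr.eval, eval_var, e3, eval_idx e1 e2 hJ, write_apply, mul_add_inj hm hl,
      true_and]
    split_ifs with h1 h2 h2
    · rw [h1.1, h1.2, h c (h1.1 ▸ hr) l hl, if_neg (by omega)]
    · omega
    · rw [h r hr m hm, if_pos (by omega)]
    · rw [h r hr m hm, if_neg (by omega)]
  · intro τ _ h r hr m hm
    rw [h r hr m hm]
    simp [hm]

def clearColumn : Prog :=
  forLoop R (var N)
    (.branch (.eq (var R) (var Col)) .skip
      (forLoop J (var N)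
        (.assign Mat (idx R J)
          (.sub (.get Mat (idx R J))
            (.mul (.get Out (var R)) (.get Mat (idx Col J)))))))

theorem clearColumn_runs {σ : Memory} {n c : ℕ} (hn : σ 0 N = n) (hc : σ 0 Col = c)
    (hcn : c < n) :
    Runs clearColumn σ (100 * (n + 1) ^ 2) fun τ =>
      ∀ r < n, ∀ m < n, τ Mat (r * n + m) =
        if r = c then σ Mat (r * n + m)
        else σ Mat (r * n + m) - σ Out r * σ Mat (c * n + m) := by
  refine Runs.mono (Runs.forLoop (c := 60 * (n + 1))
    (fun l τ => ∀ r < n, ∀ m < n, τ Mat (r * n + m) =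
      if r ≠ c ∧ r < l then σ Mat (r * n + m) - σ Out r * σ Mat (c * n + m)
      else σ Mat (r * n + m))
    hn (by decide) rfl rfl (by simp) ?_ ?_) (by nlinarith) ?_
  · intro i τ z h r hr m hm
    simpa [write_apply, Mat] using h r hr m hm
  · intro i hi τ hfr hR h
    have e1 : τ 0 N = n := by rw [hfr 0 N rfl (by decide), hn]
    have e2 : τ 0 Col = c := by rw [hfr 0 Col rfl (by decide), hc]
    have e3 : ∀ m, τ Out m = σ Out m := fun m => hfr Out m rfl (by simp [Out])
    refine (Runs.branch (c := (n + 1) * (33 + 11)) ?_ ?_).weaken (by simp [Test.cost]; omega)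
    · intro hb
      simp only [Test.Holds, eval_var, hR, e2, Nat.cast_inj] at hb
      refine (Runs.skip ?_).weaken (Nat.zero_le _)
      intro r hr m hm
      rw [h r hr m hm]
      refine if_congr ?_ rfl rfl
      omega
    · intro hb
      simp only [Test.Holds, eval_var, hR, e2, Nat.cast_inj] at hb
      -- Row `c` is excluded from all changes, so the multiple being subtracted can always be
      -- expressed by the initial entries.
      refine Runs.mono (Runs.forLoop (c := 33)
        (fun l τ' => ∀ r < n, ∀ m < n, τ' Mat (r * n + m) =
          if r ≠ c ∧ (r < i ∨ r = i ∧ m < l) then σ Mat (r * n + m) - σ Out r * σ Mat (c * n + m)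
          else σ Mat (r * n + m))
        e1 (by decide) rfl rfl ?_ ?_ ?_) le_rfl ?_
      · simpa using h
      · intro i τ z h r hr m hm
        simpa [write_apply, Mat] using h r hr m hm
      · intro l hl τ' hfr' hJ h'
        have f1 : τ' 0 N = n := by rw [hfr' 0 N rfl (by decide), e1]
        have f2 : τ' 0 Col = c := by rw [hfr' 0 Col rfl (by decide), e2]
        have f3 : ∀ m, τ' Out m = σ Out m := fun m => by
          rw [hfr' Out m rfl (by simp [Out]), e3]
        have f4 : τ' 0 R = i := by rw [hfr' 0 R rfl (by decide), hR]
        refine (Runs.assign ?_).weaken (by simp [Expr.cost])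
        intro r hr m hm
        simp only [Expr.eval, eval_var, f3, f4, eval_idx f1 f4 hJ, eval_idx f1 f2 hJ, write_apply,
          mul_add_inj hm hl, true_and, Nat.floor_natCast]
        split_ifs with h1 h2 h2
        · rw [h1.1, h1.2, h' i hi l hl, if_neg (by omega), h' c hcn l hl, if_neg (by omega)]
        · omega
        · rw [h' r hr m hm, if_pos (by omega)]
        · rw [h' r hr m hm, if_neg (by omega)]
      · intro τ' _ h' r hr m hm
        rw [h' r hr m hm]
        refine if_congr ?_ rfl rfl
        omega
  · intro τ _ h r hr m hm
    rw [h r hr m hm]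
    by_cases hrc : r = c <;> simp [hrc, hr]

def findPivot : Prog :=
  .loop (.eq (.get Out (var Piv)) (.lit 0)) (setVar Piv (.add (var Piv) (.lit 1)))

/-- The search has no bound check; it stops because a nonzero entry at some `p ≥ c` is known to
exist. The induction is on the distance to `p`. -/
theorem findPivot_runs {σ : Memory} {c p : ℕ} (hc : σ 0 Piv = c) (hcp : c ≤ p)
    (hp : σ Out p ≠ 0) :
    Runs findPivot σ (20 * (p + 1)) fun τ => ∃ q, c ≤ q ∧ q ≤ p ∧ τ 0 Piv = q ∧ σ Out q ≠ 0 := by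
  obtain ⟨d, rfl⟩ := Nat.exists_eq_add_of_le hcp
  refine Runs.weaken (c := 5 + d * 11) ?_ (by omega)
  clear hcp
  induction d generalizing σ c with
  | zero =>
    refine Runs.loop_stop ?_ ⟨c, le_rfl, le_rfl, hc, hp⟩
    simpa [Test.Holds, Expr.eval, hc] using hp
  | succ d ih =>
    by_cases h0 : σ Out c = 0
    · refine (Runs.loop_step (c := 6) ?_ (Runs.setVar ((ih (c := c + 1) ?_ ?_).mono le_rfl
        fun τ _ h => ?_))).weaken ?_
      · simpa [Test.Holds, Expr.eval, hc] using h0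
      · simp [write_apply, Expr.eval, hc]
      · rw [write_apply, if_neg (by simp [Out])]
        rwa [show c + 1 + d = c + (d + 1) by omega]
      · obtain ⟨q, h1, h2, h3, h4⟩ := h
        rw [write_apply, if_neg (by simp [Out])] at h4
        exact ⟨q, by omega, by omega, h3, h4⟩
      · simp [Test.cost, Expr.cost]; omega
    · refine (Runs.loop_stop ?_ ⟨c, le_rfl, by omega, hc, h0⟩).weaken ?_
      · simpa [Test.Holds, Expr.eval, hc] using h0
      · simp [Test.cost, Expr.cost]

def elimStep : Prog :=
  block
    [fetch Bas Col, mulVec, setVar Piv (var Col), findPivot, swapRows,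
     setVar Tmp (.get Out (var Piv)), .assign Out (var Piv) (.get Out (var Col)),
     scaleRow, clearColumn]

/-- Here `o` is the column `A b_c` before the step, and `q` is the pivot row that was found. -/
theorem elimStep_runs {σ : Memory} {n c : ℕ} (o : ℕ → ℝ) (hn : σ 0 N = n) (hc : σ 0 Col = c)
    (ho : ∀ r < n, o r = ∑ j ∈ range n, σ Mat (r * n + j) * σ Bas (c * n + j))
    (hp : ∃ p < n, c ≤ p ∧ o p ≠ 0) :
    Runs elimStep σ (1000 * (n + 1) ^ 2) fun τ => ∃ q < n, c ≤ q ∧ o q ≠ 0 ∧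
      ∀ r < n, ∀ m < n, τ Mat (r * n + m) =
        if r = c then σ Mat (q * n + m) / o q
        else σ Mat (Equiv.swap c q r * n + m) -
          o (Equiv.swap c q r) * (σ Mat (q * n + m) / o q) := by
  obtain ⟨p, hpn, hcp, hop⟩ := hp
  have hcn : c < n := by omega
  refine Runs.weaken (c := 30 * (n + 1) + (100 * (n + 1) ^ 2 + (4 + (20 * (n + 1) +
    (100 * (n + 1) + (5 + (6 + (50 * (n + 1) + (100 * (n + 1) ^ 2 + 0))))))))) ?_
    (by ring_nf; omega)
  refine Runs.block_cons ((fetch_runs hn hc (by decide) (by decide) (by decide)).mono le_rfl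
    fun τ₁ f₁ h₁ => ?_)
  have n1 : τ₁ 0 N = n := by rw [f₁ 0 N rfl, hn]
  refine Runs.block_cons ((mulVec_runs n1).mono le_rfl fun τ₂ f₂ h₂ => ?_)
  have n2 : τ₂ 0 N = n := by rw [f₂ 0 N rfl, n1]
  have c2 : τ₂ 0 Col = c := by rw [f₂ 0 Col rfl, f₁ 0 Col rfl, hc]
  have m2 : ∀ m, τ₂ Mat m = σ Mat m := fun m => by rw [f₂ Mat m rfl, f₁ Mat m rfl]
  have o2 : ∀ r < n, τ₂ Out r = o r := by
    intro r hr
    rw [h₂ r hr, ho r hr]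
    refine sum_congr rfl fun j hj => ?_
    rw [h₁ j (mem_range.1 hj), f₁ Mat _ rfl]
  clear h₂ f₂ h₁ f₁ n1
  refine Runs.block_cons (Runs.weaken (Runs.setVar ?_) (by simp))
  refine Runs.block_cons (Runs.mono (findPivot_runs (c := c) (p := p) ?_ hcp ?_) (by omega)
    fun τ₃ f₃ h₃ => ?_)
  · simp [write_apply, c2]
  · rw [write_apply, if_neg (by simp [Out]), o2 p hpn]
    exact hop
  obtain ⟨q, hcq, hqp, hq, hoq⟩ := h₃
  have hqn : q < n := by omega
  have n3 : τ₃ 0 N = n := by rw [f₃ 0 N rfl, write_apply, if_neg (by decide), n2]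
  have c3 : τ₃ 0 Col = c := by rw [f₃ 0 Col rfl, write_apply, if_neg (by decide), c2]
  have m3 : ∀ m, τ₃ Mat m = σ Mat m := fun m => by
    rw [f₃ Mat m rfl, write_apply, if_neg (by simp [Mat]), m2]
  have o3 : ∀ r < n, τ₃ Out r = o r := fun r hr => by
    rw [f₃ Out r rfl, write_apply, if_neg (by simp [Out]), o2 r hr]
  rw [write_apply, if_neg (by simp [Out]), o2 q hqn] at hoq
  clear f₃ n2 c2 m2 o2
  refine Runs.block_cons (Runs.mono (swapRows_runs n3 c3 hq hcn hqn) le_rfl fun τ₄ f₄ h₄ => ?_)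
  have n4 : τ₄ 0 N = n := by rw [f₄ 0 N rfl, n3]
  have c4 : τ₄ 0 Col = c := by rw [f₄ 0 Col rfl, c3]
  have q4 : τ₄ 0 Piv = q := by rw [f₄ 0 Piv rfl, hq]
  have o4 : ∀ r < n, τ₄ Out r = o r := fun r hr => by rw [f₄ Out r rfl, o3 r hr]
  have m4 : ∀ r < n, ∀ m < n, τ₄ Mat (r * n + m) = σ Mat (Equiv.swap c q r * n + m) :=
    fun r hr m hm => by rw [h₄ r hr m hm, m3]
  clear f₄ h₄ n3 c3 hq m3 o3
  refine Runs.block_cons (Runs.weaken (Runs.setVar ?_) (by simp [Expr.cost]))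
  obtain ⟨τ₅, h5⟩ : ∃ τ₅, τ₅ = write τ₄ 0 Tmp ((Expr.get Out (var Piv)).eval τ₄) := ⟨_, rfl⟩
  rw [← h5]
  have z5 : ∀ x, x ≠ Tmp → τ₅ 0 x = τ₄ 0 x := fun x hx => by
    rw [h5, write_apply, if_neg (by simp [hx])]
  have t5 : τ₅ 0 Tmp = o q := by
    rw [h5, write_apply, if_pos ⟨rfl, rfl⟩, Expr.eval, eval_var, q4, Nat.floor_natCast, o4 q hqn]
  have a5 : ∀ a m, a ≠ 0 → τ₅ a m = τ₄ a m := fun a m ha => by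
    rw [h5, write_apply, if_neg (by simp [ha])]
  refine Runs.block_cons (Runs.weaken (Runs.assign ?_) (by simp [Expr.cost]))
  obtain ⟨τ₆, h6⟩ : ∃ τ₆, τ₆ = write τ₅ Out ⌊(var Piv).eval τ₅⌋₊
    ((Expr.get Out (var Col)).eval τ₅) := ⟨_, rfl⟩
  rw [← h6]
  have z6 : ∀ x, τ₆ 0 x = τ₅ 0 x := fun x => by rw [h6, write_apply, if_neg (by simp [Out])]
  have m6 : ∀ m, τ₆ Mat m = τ₄ Mat m := fun m => by
    rw [h6, write_apply, if_neg (by simp [Out, Mat]), a5 _ _ (by decide)]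
  -- The column is only half swapped: entry `q` receives the old entry `c`, while entry `c` is left
  -- stale. This is harmless, since `clearColumn` skips row `c`.
  have o6 : ∀ r < n, r ≠ c → τ₆ Out r = o (Equiv.swap c q r) := fun r hr hrc => by
    rw [h6, write_apply, eval_var, Expr.eval, eval_var, z5 Piv (by decide), z5 Col (by decide),
      q4, c4, Nat.floor_natCast, Nat.floor_natCast, a5 _ _ (by decide), a5 _ _ (by decide),
      o4 c hcn, o4 r hr]
    by_cases hrq : r = q <;> simp [hrq, hrc, Equiv.swap_apply_def]
  refine Runs.block_cons (Runs.mono (scaleRow_runs (n := n) (c := c) ?_ ?_) le_rfl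
    fun τ₇ f₇ h₇ => ?_)
  · rw [z6, z5 N (by decide), n4]
  · rw [z6, z5 Col (by decide), c4]
  refine Runs.block_cons (Runs.mono (clearColumn_runs (n := n) (c := c) ?_ ?_ hcn) le_rfl
    fun τ₈ f₈ h₈ => Runs.block_nil ?_)
  · rw [f₇ 0 N rfl, z6, z5 N (by decide), n4]
  · rw [f₇ 0 Col rfl, z6, z5 Col (by decide), c4]
  refine ⟨q, hqn, hcq, hoq, fun r hr m hm => ?_⟩
  rw [h₈ r hr m hm, h₇ r hr m hm, h₇ c hcn m hm, z6, t5, m6, m6, m4 r hr m hm, m4 c hcn m hm,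
    f₇ Out r rfl, Equiv.swap_apply_left, if_pos rfl]
  by_cases hrc : r = c
  · simp [hrc]
  · rw [if_neg hrc, if_neg hrc, if_neg hrc, o6 r hr hrc]

theorem updateInverse_eq :
    updateInverse = block [setOne, forLoop Col (var K) elimStep] := rfl

/-! ### Gram determinants -/

section Gram

variable {E : Type*} [NormedAddCommGroup E] [InnerProductSpace ℝ E]

/-- The Gram determinant of the first `k` vectors of a sequence. -/
noncomputable def gramDet (b : ℕ → E) (k : ℕ) : ℝ :=
  (Matrix.gram ℝ fun i : Fin k => b i).det

/-- The determinant is positive because the Gram matrix is positive definite, and an integer because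
its entries are. -/
theorem one_le_gramDet {b : ℕ → E} {k : ℕ} (hb : LinearIndependent ℝ fun i : Fin k => b i)
    (hint : ∀ i < k, ∀ j < k, ∃ m : ℤ, inner ℝ (b i) (b j) = (m : ℝ)) : 1 ≤ gramDet b k := by
  have hpos : 0 < gramDet b k := (Matrix.posDef_gram_of_linearIndependent hb).det_pos
  choose M hM using fun i j : Fin k => hint i i.2 j j.2
  have h : gramDet b k = ((Matrix.of M).det : ℤ) := by
    rw [gramDet, ← eq_intCast (Int.castRingHom ℝ), RingHom.map_det]
    congr 1
    ext i j
    simpa using hM i j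
  rw [h] at hpos ⊢
  exact_mod_cast hpos

/-- With `M` the identity matrix whose row `p` is replaced by `y`, the Gram matrices satisfy `G' = M
G Mᵀ`, and `det M = y p`. -/
theorem gramDet_update {b b' : ℕ → E} {k p : ℕ} (hp : p < k) (y : ℕ → ℝ)
    (hb : ∀ i < k, i ≠ p → b' i = b i) (hbp : b' p = ∑ i ∈ range k, y i • b i) :
    gramDet b' k = y p ^ 2 * gramDet b k := by
  set M : Matrix (Fin k) (Fin k) ℝ := Matrix.updateRow 1 ⟨p, hp⟩ fun i => y i with hM
  -- After transposition this is Cramer's rule for the identity matrix.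
  have hdet : M.det = y p := by
    rw [hM, ← Matrix.det_transpose, ← Matrix.updateCol_transpose, Matrix.transpose_one,
      ← Matrix.cramer_apply, Matrix.cramer_one]
    rfl
  have hbM : ∀ i : Fin k, b' i = ∑ j, M i j • b j := by
    intro i
    by_cases hi : i = ⟨p, hp⟩
    · subst hi
      simp only [hM, Matrix.updateRow_self]
      rw [hbp, sum_range]
    · rw [hb i i.2 (fun h => hi (Fin.ext h))]
      simp [hM, Matrix.updateRow_ne hi, Matrix.one_apply]
  have hG : (Matrix.gram ℝ fun i : Fin k => b' i) =
      M * (Matrix.gram ℝ fun i : Fin k => b i) * M.transpose := by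
    ext i j
    simp only [Matrix.gram_apply, hbM, sum_inner, inner_sum, inner_smul_left, inner_smul_right,
      Matrix.mul_apply, Matrix.transpose_apply, sum_mul, mul_sum]
    refine sum_congr rfl fun l _ => sum_congr rfl fun l' _ => ?_
    simp
    ring
  rw [gramDet, hG, Matrix.det_mul, Matrix.det_mul, Matrix.det_transpose, hdet, gramDet]
  ring

/-- By the Schur complement the quotient of the two determinants is `‖b k‖² - wᵀ A⁻¹ w`, where `w`
collects the inner products with `b k`; the subtracted term is nonnegative as `A⁻¹` is positive
definite. -/
theorem gramDet_succ_le {b : ℕ → E} {k : ℕ} (hb : LinearIndependent ℝ fun i : Fin k => b i) :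
    gramDet b (k + 1) ≤ gramDet b k * ‖b k‖ ^ 2 := by
  set A := Matrix.gram ℝ fun i : Fin k => b i with hA
  have hpos : A.PosDef := Matrix.posDef_gram_of_linearIndependent hb
  set w : Matrix (Fin k) (Fin 1) ℝ := Matrix.of fun i _ => inner ℝ (b i) (b k) with hw
  have hblock : (Matrix.gram ℝ fun i : Fin (k + 1) => b i).submatrix finSumFinEquiv finSumFinEquiv
      = Matrix.fromBlocks A w w.transpose (Matrix.of fun _ _ => ‖b k‖ ^ 2) := by
    ext i j
    rcases i with i | i <;> rcases j with j | j <;>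
      simp [Matrix.gram_apply, hA, hw, real_inner_comm]
  have : Invertible A := A.invertibleOfIsUnitDet (hpos.det_pos.ne'.isUnit)
  rw [gramDet, ← Matrix.det_submatrix_equiv_self finSumFinEquiv, hblock,
    Matrix.det_fromBlocks₁₁, gramDet]
  refine mul_le_mul_of_nonneg_left ?_ hpos.det_pos.le
  rw [Matrix.det_unique, Matrix.sub_apply]
  have h := (hpos.inv.posSemidef).dotProduct_mulVec_nonneg (fun i => w i 0)
  have h' : (w.transpose * ⅟A * w) default default =
      star (fun i => w i 0) ⬝ᵥ (A⁻¹.mulVec fun i => w i 0) := by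
    rw [Matrix.invOf_eq_nonsing_inv, Matrix.mul_assoc]
    simp [Matrix.mul_apply, dotProduct, Matrix.mulVec]
  rw [h']
  simpa using h

end Gram

/-- The exchange `(b_p, v) ↦ (v - z b_p, b_p)` is invertible over `ℤ`: `v` is recovered as `b'_p + z
b_p`. -/
theorem span_insert_update {E : Type*} [AddCommGroup E] {b b' : ℕ → E} {k p : ℕ} (hp : p < k) (z : ℤ) {v : E}
    (hb : ∀ i < k, i ≠ p → b' i = b i) (hbp : b' p = v - z • b p) :
    Submodule.span ℤ (insert (b p) (Set.range fun i : Fin k => b' i)) =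
      Submodule.span ℤ (insert v (Set.range fun i : Fin k => b i)) := by
  apply le_antisymm <;> rw [Submodule.span_le, Set.insert_subset_iff]
  · have hmem : ∀ i < k, b i ∈ Submodule.span ℤ (insert v (Set.range fun i : Fin k => b i)) :=
      fun i hi => Submodule.subset_span (Set.mem_insert_of_mem _ ⟨⟨i, hi⟩, rfl⟩)
    refine ⟨hmem p hp, ?_⟩
    rintro _ ⟨i, rfl⟩
    by_cases hi : i.1 = p
    · simp only [hi, hbp]
      exact Submodule.sub_mem _ (Submodule.subset_span (Set.mem_insert _ _))
        (Submodule.smul_mem _ _ (hmem p hp))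
    · simp only [hb i i.2 hi]
      exact hmem i i.2
  · have hmem : ∀ i < k, b' i ∈
        Submodule.span ℤ (insert (b p) (Set.range fun i : Fin k => b' i)) :=
      fun i hi => Submodule.subset_span (Set.mem_insert_of_mem _ ⟨⟨i, hi⟩, rfl⟩)
    have hpm : b p ∈ Submodule.span ℤ (insert (b p) (Set.range fun i : Fin k => b' i)) :=
      Submodule.subset_span (Set.mem_insert _ _)
    constructor
    · have : v = b' p + z • b p := by rw [hbp, sub_add_cancel]
      rw [this]
      exact Submodule.add_mem _ (hmem p hp) (Submodule.smul_mem _ _ hpm)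
    · rintro _ ⟨i, rfl⟩
      by_cases hi : i.1 = p
      · simp only [hi]; exact hpm
      · simp only [← hb i i.2 hi]
        exact hmem i i.2

/-! ### Coordinates -/

section Clears

variable {E : Type*} [AddCommGroup E] [Module ℝ E]

/-- The linear map `f`, of which only the first `n` coordinates count, is injective and maps the
first `c` vectors of the sequence `b` to the first `c` unit vectors. -/
def Clears (f : E →ₗ[ℝ] (ℕ → ℝ)) (b : ℕ → E) (c n : ℕ) : Prop :=
  (∀ x, (∀ r < n, f x r = 0) → x = 0) ∧ ∀ i < c, ∀ r < n, f (b i) r = if r = i then 1 else 0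

variable {f : E →ₗ[ℝ] (ℕ → ℝ)} {b : ℕ → E} {c n : ℕ}

/-- Both sides have the same first `n` coordinates, and these determine a vector. -/
theorem Clears.eq_sum (h : Clears f b c n) {v : E} (hv : ∀ r < n, c ≤ r → f v r = 0) :
    v = ∑ i ∈ range c, f v i • b i := by
  rw [← sub_eq_zero]
  refine h.1 _ fun r hr => ?_
  have : ∀ i ∈ range c, (f v i • f (b i)) r = if r = i then f v i else 0 := by
    intro i hi
    rw [Pi.smul_apply, h.2 i (mem_range.1 hi) r hr]
    simp
  simp only [map_sub, map_sum, map_smul, Pi.sub_apply, Finset.sum_apply]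
  rw [sum_congr rfl this, sum_ite_eq]
  split_ifs with hrc
  · simp
  · rw [hv r hr (by simpa using hrc), sub_zero]

/-- Otherwise `b c` would be a combination of the earlier vectors by `Clears.eq_sum`, against
independence. -/
theorem Clears.exists_pivot (h : Clears f b c n) {k : ℕ}
    (hb : LinearIndependent ℝ fun i : Fin k => b i) (hck : c < k) :
    ∃ p < n, c ≤ p ∧ f (b c) p ≠ 0 := by
  by_contra! hcon
  have hs := h.eq_sum hcon
  have hmem : b c ∈ Submodule.span ℝ ((fun i : Fin k => b i) '' {i | i.1 < c}) := by
    rw [hs]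
    refine Submodule.sum_mem _ fun i hi => Submodule.smul_mem _ _ (Submodule.subset_span ?_)
    have hi' := mem_range.1 hi
    exact ⟨⟨i, by omega⟩, hi', rfl⟩
  exact hb.notMem_span_image (s := {i | i.1 < c}) (x := ⟨c, hck⟩) (by simp) hmem

theorem swap_lt {c q r n : ℕ} (hc : c < n) (hq : q < n) (hr : r < n) :
    Equiv.swap c q r < n := by
  rw [Equiv.swap_apply_def]; split_ifs <;> assumption

/-- The row operations are invertible, so injectivity survives. The earlier vectors keep their unit
coordinates because their `q`-th coordinate vanishes, `q` being at least `c`. -/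
theorem Clears.step (h : Clears f b c n) {f' : E →ₗ[ℝ] (ℕ → ℝ)} {q : ℕ} (hcn : c < n)
    (hq : q < n) (hcq : c ≤ q) (hfq : f (b c) q ≠ 0)
    (hf' : ∀ x, ∀ r < n, f' x r = if r = c then f x q / f (b c) q
      else f x (Equiv.swap c q r) - f (b c) (Equiv.swap c q r) * (f x q / f (b c) q)) :
    Clears f' b (c + 1) n := by
  constructor
  · intro x hx
    have h0 : f x q = 0 := by
      have := hx c hcn
      rw [hf' x c hcn, if_pos rfl] at this
      exact (div_eq_zero_iff.1 this).resolve_right hfq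
    refine h.1 x fun r hr => ?_
    by_cases hrq : r = q
    · rw [hrq, h0]
    · have hlt := swap_lt hcn hq hr
      have := hx _ hlt
      rw [hf' x _ hlt, if_neg, Equiv.swap_apply_self, h0] at this
      · simpa using this
      · intro he
        rw [Equiv.swap_apply_eq_iff, Equiv.swap_apply_left] at he
        exact hrq he
  · intro i hi r hr
    rw [hf' _ r hr]
    rcases Nat.lt_succ_iff_lt_or_eq.1 hi with hi | rfl
    · have hz : f (b i) q = 0 := by rw [h.2 i hi q hq, if_neg (by omega)]
      rw [hz, zero_div, mul_zero, sub_zero, h.2 i hi _ (swap_lt hcn hq hr)]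
      by_cases hrc : r = c
      · rw [if_pos hrc, if_neg (by omega)]
      · rw [if_neg hrc]
        refine if_congr ?_ rfl rfl
        rw [Equiv.swap_apply_eq_iff, Equiv.swap_apply_of_ne_of_ne (by omega) (by omega)]
    · rw [div_self hfq, mul_one, sub_self]

theorem Clears.mem_span_iff (h : Clears f b c n) (hcn : c ≤ n) (v : E) :
    v ∈ Submodule.span ℤ (Set.range fun i : Fin c => b i) ↔ ∀ r < n, ¬ Bad c r (f v r) := by
  constructor
  · intro hv r hr
    obtain ⟨z, rfl⟩ := (Submodule.mem_span_range_iff_exists_fun ℤ).1 hv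
    have : f (∑ i, z i • b i) r = ∑ i : Fin c, if r = i then (z i : ℝ) else 0 := by
      simp only [map_sum, map_zsmul, Finset.sum_apply]
      refine sum_congr rfl fun i _ => ?_
      rw [Pi.smul_apply, h.2 i i.2 r hr]
      simp
    rw [this, Bad]
    split_ifs with hrc
    · intro hall
      refine hall (z ⟨r, hrc⟩) ?_
      rw [sum_eq_single ⟨r, hrc⟩]
      · simp
      · intro i _ hi
        exact if_neg fun h => hi (Fin.ext h.symm)
      · simp
    · refine not_not.2 (sum_eq_zero fun i _ => if_neg ?_)
      have := i.2
      omega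
  · intro hv
    rw [h.eq_sum (v := v) fun r hr hcr => ?_]
    · refine Submodule.sum_mem _ fun i hi => ?_
      have hi' := mem_range.1 hi
      have := hv i (by omega)
      rw [Bad, if_pos hi'] at this
      push Not at this
      obtain ⟨z, hz⟩ := this
      rw [hz, Int.cast_smul_eq_zsmul]
      exact Submodule.smul_mem _ _ (Submodule.subset_span ⟨⟨i, hi'⟩, rfl⟩)
    · have := hv r hr
      rw [Bad, if_neg (by omega)] at this
      exact not_not.1 this

/-- The relation can be solved for `b p` since `y p ≠ 0`. So after an exchange the vector to be
inserted still lies in the real span, and the subroutine goes on exchanging without appending. -/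
theorem mem_span_of_update {b' : ℕ → E} {k p : ℕ} (hp : p < k) (y : ℕ → ℝ) (hy : y p ≠ 0)
    (hb : ∀ i < k, i ≠ p → b' i = b i) (hbp : b' p = ∑ i ∈ range k, y i • b i) :
    b p ∈ Submodule.span ℝ (Set.range fun i : Fin k => b' i) := by
  have hmem : ∀ i < k, b' i ∈ Submodule.span ℝ (Set.range fun i : Fin k => b' i) :=
    fun i hi => Submodule.subset_span ⟨⟨i, hi⟩, rfl⟩
  rw [← add_sum_erase _ _ (mem_range.2 hp)] at hbp
  have : b p = (y p)⁻¹ • (b' p - ∑ i ∈ (range k).erase p, y i • b i) := by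
    rw [hbp, add_sub_cancel_right, smul_smul, inv_mul_cancel₀ hy, one_smul]
  rw [this]
  refine Submodule.smul_mem _ _ (Submodule.sub_mem _ (hmem p hp) (Submodule.sum_mem _ fun i hi => ?_))
  rw [mem_erase, mem_range] at hi
  rw [← hb i hi.2 hi.1]
  exact Submodule.smul_mem _ _ (hmem i hi.2)

end Clears

/-- The first `n` entries of `fun r => (A x) r`, for the matrix `A` in `Mat`. -/
noncomputable def coords (σ : Memory) (n : ℕ) : EuclideanSpace ℝ (Fin n) →ₗ[ℝ] (ℕ → ℝ) where
  toFun x r := ∑ j : Fin n, σ Mat (r * n + j) * x j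
  map_add' x y := by
    funext r
    simp [mul_add, sum_add_distrib]
  map_smul' c x := by
    funext r
    simp only [PiLp.smul_apply, smul_eq_mul, RingHom.id_apply, Pi.smul_apply, mul_sum]
    exact sum_congr rfl fun j _ => by ring

theorem coords_apply (σ : Memory) (n : ℕ) (x : EuclideanSpace ℝ (Fin n)) (r : ℕ) :
    coords σ n x r = ∑ j : Fin n, σ Mat (r * n + j) * x j := rfl

theorem coords_vecAt (σ τ : Memory) (a n i r : ℕ) :
    coords σ n (vecAt τ a n i) r = ∑ j ∈ range n, σ Mat (r * n + j) * τ a (i * n + j) := by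
  rw [coords_apply, sum_range]
  rfl

theorem coords_congr {σ τ : Memory} (n : ℕ) (h : ∀ m, τ Mat m = σ Mat m) :
    coords τ n = coords σ n := by
  ext x r
  simp [coords_apply, h]

theorem vecAt_congr {σ τ : Memory} {a a' n i i' : ℕ}
    (h : ∀ j < n, τ a' (i' * n + j) = σ a (i * n + j)) : vecAt τ a' n i' = vecAt σ a n i := by
  ext j
  exact h j j.2

theorem le_of_linearIndependent {n k : ℕ} {b : Fin k → EuclideanSpace ℝ (Fin n)}
    (hb : LinearIndependent ℝ b) : k ≤ n := by
  simpa using hb.fintype_card_le_finrank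

/-- The complement `w₁, …, w_{n-k}` need not be named: injectivity of `A` replaces the statement
that `A` is the inverse of the matrix with columns `b` and `w`. -/
theorem updateInverse_runs {σ : Memory} {n k : ℕ} (hn : σ 0 N = n) (hk : σ 0 K = k)
    (hb : LinearIndependent ℝ fun i : Fin k => vecAt σ Bas n i) :
    Runs updateInverse σ (2000 * (n + 1) ^ 3) fun τ =>
      Clears (coords τ n) (vecAt σ Bas n) k n := by
  have hkn := le_of_linearIndependent hb
  rw [updateInverse_eq]
  refine Runs.weaken (c := 100 * (n + 1) ^ 2 + ((k + 1) * (1000 * (n + 1) ^ 2 + 11) + 0)) ?_ ?_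
  · refine Runs.block_cons ((setOne_runs hn).mono le_rfl fun τ f h => Runs.block_cons
      (Runs.mono (Runs.forLoop
        (fun i τ => Clears (coords τ n) (vecAt σ Bas n) i n)
        (n := k) ?_ (by decide) rfl rfl ?_ ?_ ?_) le_rfl fun _ _ h => Runs.block_nil h))
    · rw [f 0 K rfl, hk]
    -- For `c = 0` only the injectivity of the identity matrix is at stake.
    · refine ⟨fun x hx => ?_, fun i hi => absurd hi (Nat.not_lt_zero i)⟩
      ext j
      rw [PiLp.zero_apply, ← hx j j.2, coords_apply, sum_eq_single j]
      · rw [h j j.2 j j.2, if_pos rfl, one_mul]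
      · intro l _ hl
        rw [h j j.2 l l.2, if_neg fun h => hl (Fin.ext h.symm), zero_mul]
      · simp
    · intro i τ z h
      rwa [coords_congr (τ := write τ 0 Col z) (σ := τ)]
      intro m
      rw [write_apply, if_neg (by simp [Mat])]
    · intro c hck τ' f' hcol hcl
      have hB : ∀ i, vecAt τ' Bas n i = vecAt σ Bas n i := fun i => vecAt_congr fun j _ => by
        rw [f' Bas _ rfl (by simp [Bas]), f Bas _ rfl]
      refine (elimStep_runs (fun r => coords τ' n (vecAt σ Bas n c) r) (n := n) ?_ hcol ?_
        (hcl.exists_pivot hb hck)).mono le_rfl fun τ'' f'' h'' => ?_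
      · rw [f' 0 N rfl (by decide), f 0 N rfl, hn]
      · intro r hr
        simp only [← hB, coords_vecAt]
      · obtain ⟨q, hq, hcq, hoq, hent⟩ := h''
        refine hcl.step (by omega) hq hcq hoq fun x r hr => ?_
        rw [coords_apply, sum_congr rfl fun j _ => by rw [hent r hr j j.2]]
        split_ifs with hrc
        · rw [coords_apply τ' n x q, sum_div]
          exact sum_congr rfl fun j _ => by ring
        · rw [coords_apply τ' n x q, coords_apply τ' n x (Equiv.swap c q r), sum_div, mul_sum,
            ← sum_sub_distrib]
          exact sum_congr rfl fun j _ => by ring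
  · have : (k + 1) * (1000 * (n + 1) ^ 2 + 11) ≤ (n + 1) * (1000 * (n + 1) ^ 2 + 11) :=
      Nat.mul_le_mul_right _ (by omega)
    refine (Nat.add_le_add_left (Nat.add_le_add_right this 0) _).trans ?_
    ring_nf; omega

/-! ### The subroutine -/

/-- The array that keeps the vector to be inserted into the basis. -/
def Keep : ℕ := 8

def copyVec (a a' : ℕ) : Prog := forLoop J (var N) (.assign a' (var J) (.get a (var J)))

theorem copyVec_runs {σ : Memory} {a a' n : ℕ} (hn : σ 0 N = n) (haa : a ≠ a') (ha : a ≠ 0)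
    (ha' : a' ≠ 0) :
    Runs (copyVec a a') σ (30 * (n + 1)) fun τ => vecAt τ a' n 0 = vecAt σ a n 0 := by
  refine Runs.mono (Runs.forLoop (c := 6) (fun l τ => ∀ j < l, τ a' j = σ a j)
    hn (by decide) ?_ ?_ (by simp) ?_ ?_) (by omega) fun τ _ h => vecAt_congr fun j hj => ?_
  · simp [Prog.writes, ha'.symm]
  · simp [Prog.writes, ha'.symm]
  · intro i τ z h r hr
    rw [write_apply, if_neg (by simp [ha']), h r hr]
  · intro l hl τ hfr hJ h
    refine (Runs.assign ?_).weaken (by simp [Expr.cost])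
    have e : ∀ m, τ a m = σ a m := fun m => hfr a m (by simp [Prog.writes, haa]) (by simp [ha])
    intro j hj
    simp only [eval_var, hJ, Nat.floor_natCast, write_apply, Expr.eval, e, true_and]
    split_ifs with hc
    · rw [hc]
    · exact h j (by omega)
  · simpa using h j hj

def appendStep : Prog :=
  block [forLoop J (var N) (.assign Bas (idx K J) (.get Keep (var J))),
    setVar K (.add (var K) (.lit 1))]

theorem appendStep_runs {σ : Memory} {n k : ℕ} (hn : σ 0 N = n) (hk : σ 0 K = k) :
    Runs appendStep σ (100 * (n + 1)) fun τ => τ 0 K = (k + 1 : ℕ) ∧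
      vecAt τ Bas n k = vecAt σ Keep n 0 ∧ ∀ i ≠ k, vecAt τ Bas n i = vecAt σ Bas n i := by
  refine Runs.weaken (c := (n + 1) * (12 + 11) + (6 + 0)) (Runs.block_cons (Runs.mono
    (Runs.forLoop (c := 12) (fun l τ => ∀ i, ∀ j < n, τ Bas (i * n + j) =
      if i = k ∧ j < l then σ Keep j else σ Bas (i * n + j))
    hn (by decide) rfl rfl (by simp) ?_ ?_) le_rfl fun τ hfr h =>
      Runs.block_cons (Runs.weaken (Runs.setVar (Runs.block_nil ?_)) (by simp [Expr.cost]))))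
    (by omega)
  · intro l τ z h i j hj
    simpa [write_apply, Bas] using h i j hj
  · intro l hl τ hfr hJ h
    refine (Runs.assign ?_).weaken (by simp [Expr.cost])
    have e1 : τ 0 N = n := by rw [hfr 0 N rfl (by decide), hn]
    have e2 : τ 0 K = k := by rw [hfr 0 K rfl (by decide), hk]
    have e3 : ∀ m, τ Keep m = σ Keep m := fun m => hfr Keep m rfl (by simp [Keep])
    intro i j hj
    simp only [eval_idx e1 e2 hJ, write_apply, Expr.eval, eval_var, hJ, Nat.floor_natCast, e3,
      true_and, mul_add_inj hj hl]
    split_ifs with h1 h2 h2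
    · rw [h1.2]
    · omega
    · rw [h i j hj, if_pos (by omega)]
    · rw [h i j hj, if_neg (by omega)]
  · have hB : ∀ i, ∀ j < n, write τ 0 K (((var K).add (.lit 1)).eval τ) Bas (i * n + j) =
        if i = k then σ Keep j else σ Bas (i * n + j) := by
      intro i j hj
      rw [write_apply, if_neg (by simp [Bas]), h i j hj]
      simp [hj]
    refine ⟨?_, vecAt_congr fun j hj => ?_, fun i hi => vecAt_congr fun j hj => ?_⟩
    · simp [write_apply, Expr.eval, hfr 0 K rfl, hk]
    · rw [hB k j hj, if_pos rfl, zero_mul, zero_add]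
    · rw [hB i j hj, if_neg hi]

/-- The Euclidean step. `Tmp` is the integer nearest to the `Piv`-th coordinate; the basis vector
displaced from `Bas` goes to `Keep`. `Col` is merely a scratch scalar here. -/
def swapStep : Prog :=
  block [setVar Tmp (.floor (.add (.get Out (var Piv)) (.div (.lit 1) (.lit 2)))),
    forLoop J (var N) (block
      [setVar Col (.get Bas (idx Piv J)),
       .assign Bas (idx Piv J) (.sub (.get Keep (var J)) (.mul (var Tmp) (var Col))),
       .assign Keep (var J) (var Col)])]

theorem swapStep_runs {σ : Memory} {n p : ℕ} (hn : σ 0 N = n) (hp : σ 0 Piv = p) :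
    Runs swapStep σ (100 * (n + 1)) fun τ =>
      vecAt τ Keep n 0 = vecAt σ Bas n p ∧
      vecAt τ Bas n p = vecAt σ Keep n 0 - ⌊σ Out p + 1 / 2⌋ • vecAt σ Bas n p ∧
      ∀ i ≠ p, vecAt τ Bas n i = vecAt σ Bas n i := by
  set z := ⌊σ Out p + 1 / 2⌋ with hz
  refine Runs.weaken (c := 10 + ((n + 1) * (50 + 11) + 0)) (Runs.block_cons
    (Runs.weaken (Runs.setVar (Runs.block_cons (Runs.mono
    (Runs.forLoop (c := 50) (fun l τ =>
      (∀ i, ∀ j < n, τ Bas (i * n + j) =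
        if i = p ∧ j < l then σ Keep j - z * σ Bas (p * n + j) else σ Bas (i * n + j)) ∧
      ∀ j < n, τ Keep j = if j < l then σ Bas (p * n + j) else σ Keep j)
    (n := n) ?_ (by decide) rfl rfl ?_ ?_ ?_) le_rfl fun τ hfr h => Runs.block_nil ?_)))
    (by simp [Expr.cost]))) (by omega)
  · rw [write_apply, if_neg (by decide), hn]
  · refine ⟨fun i j hj => ?_, fun j hj => ?_⟩ <;> simp [write_apply, Bas, Keep]
  · intro l τ x h
    refine ⟨fun i j hj => ?_, fun j hj => ?_⟩
    · simpa [write_apply, Bas] using h.1 i j hj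
    · simpa [write_apply, Keep] using h.2 j hj
  · intro l hl τ hfr hJ h
    have e1 : τ 0 N = n := by rw [hfr 0 N rfl (by decide), write_apply, if_neg (by decide), hn]
    have e2 : τ 0 Piv = p := by
      rw [hfr 0 Piv rfl (by decide), write_apply, if_neg (by decide), hp]
    have e3 : τ 0 Tmp = z := by
      rw [hfr 0 Tmp rfl (by decide), write_apply, if_pos ⟨rfl, rfl⟩, hz]
      simp [Expr.eval, hp]
    refine (Runs.block_cons (c' := 18 + 5) (Runs.setVar (Runs.block_cons (c' := 5)
      (Runs.assign (Runs.block_cons (c' := 0) (Runs.assign (Runs.block_nil ?_))))))).weaken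
      (by simp [Expr.cost])
    obtain ⟨τ₁, h1⟩ : ∃ τ₁, τ₁ = write τ 0 Col ((Expr.get Bas (idx Piv J)).eval τ) := ⟨_, rfl⟩
    have f0 : ∀ x ≠ Col, τ₁ 0 x = τ 0 x := fun x hx => by
      rw [h1, write_apply, if_neg (by simp [hx])]
    have f5 : τ₁ 0 Col = σ Bas (p * n + l) := by
      rw [h1, write_apply, if_pos ⟨rfl, rfl⟩, Expr.eval, eval_idx e1 e2 hJ, h.1 p l hl,
        if_neg (by omega)]
    have f6 : ∀ a ≠ 0, ∀ m, τ₁ a m = τ a m := fun a ha m => by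
      rw [h1, write_apply, if_neg (by simp [ha])]
    rw [← h1]
    obtain ⟨τ₂, h2⟩ : ∃ τ₂, τ₂ = write τ₁ Bas ⌊(idx Piv J).eval τ₁⌋₊
      (((Expr.get Keep (var J)).sub ((var Tmp).mul (var Col))).eval τ₁) := ⟨_, rfl⟩
    have g : ∀ x, τ₂ 0 x = τ₁ 0 x := fun x => by rw [h2, write_apply, if_neg (by simp [Bas])]
    have g6 : ∀ m, τ₂ Bas m = if m = p * n + l then σ Keep l - z * σ Bas (p * n + l)
        else τ Bas m := fun m => by
      rw [h2, write_apply, eval_idx ((f0 _ (by decide)).trans e1) ((f0 _ (by decide)).trans e2)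
        ((f0 _ (by decide)).trans hJ), f6 _ (by decide)]
      simp only [Expr.eval, eval_var, f0 J (by decide), hJ, Nat.floor_natCast,
        f6 Keep (by decide), f0 Tmp (by decide), e3, f5, h.2 l hl, lt_irrefl, if_false, true_and]
    have g7 : ∀ m, τ₂ Keep m = τ Keep m := fun m => by
      rw [h2, write_apply, if_neg (by simp [Keep, Bas]), f6 _ (by decide)]
    rw [← h2]
    refine ⟨fun i j hj => ?_, fun j hj => ?_⟩
    · rw [write_apply, if_neg (by simp [Keep, Bas]), g6, h.1 i j hj]
      simp only [mul_add_inj hj hl]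
      split_ifs with h1 h2 h2 h3 h3
      · rw [h1.2]
      · omega
      · rfl
      · omega
      · omega
      · rfl
    · simp only [write_apply, eval_var, g, f0 J (by decide), hJ, Nat.floor_natCast, f5, true_and,
        g7]
      split_ifs with h1 h2 h2
      · rw [h1]
      · omega
      · rw [h.2 j hj, if_pos (by omega)]
      · rw [h.2 j hj, if_neg (by omega)]
  · refine ⟨vecAt_congr fun j hj => ?_, ?_, fun i hi => vecAt_congr fun j hj => ?_⟩
    · rw [zero_mul, zero_add, h.2 j hj, if_pos hj]
    · ext j
      have : τ Bas (p * n + j) = _ := h.1 p j j.2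
      simp [vecAt, this]
    · rw [h.1 i j hj, if_neg (by tauto)]

/-- Recompute `A`, the coordinates of the vector in `Keep`, and the last bad coordinate. -/
def refresh : Prog := block [updateInverse, copyVec Keep Vec, findBad]

/-- The memory after a refresh. -/
structure Ready (σ : Memory) (n k : ℕ) : Prop where
  dim : σ 0 N = n
  card : σ 0 K = k
  li : LinearIndependent ℝ fun i : Fin k => vecAt σ Bas n i
  clears : Clears (coords σ n) (vecAt σ Bas n) k n
  out : ∀ r < n, σ Out r = coords σ n (vecAt σ Keep n 0) r
  piv : (σ 0 Piv = n ∧ ∀ r < n, ¬ Bad k r (σ Out r)) ∨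
    ∃ p < n, σ 0 Piv = p ∧ Bad k p (σ Out p) ∧ ∀ r < n, p < r → ¬ Bad k r (σ Out r)

theorem refresh_runs {σ : Memory} {n k : ℕ} (hn : σ 0 N = n) (hk : σ 0 K = k)
    (hb : LinearIndependent ℝ fun i : Fin k => vecAt σ Bas n i) :
    Runs refresh σ (3000 * (n + 1) ^ 3) fun τ => Ready τ n k := by
  refine Runs.weaken (c := 2000 * (n + 1) ^ 3 + (30 * (n + 1) + (200 * (n + 1) ^ 2 + 0)))
    (Runs.block_cons ((updateInverse_runs hn hk hb).mono le_rfl fun τ₁ f₁ h₁ => Runs.block_cons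
      ((copyVec_runs (n := n) ?_ (by decide) (by decide) (by decide)).mono le_rfl fun τ₂ f₂ h₂ =>
      Runs.block_cons ((findBad_runs (n := n) (k := k) ?_ ?_).mono le_rfl fun τ₃ f₃ h₃ =>
      Runs.block_nil ?_)))) (by ring_nf; omega)
  · rw [f₁ 0 N rfl, hn]
  · rw [f₂ 0 N rfl, f₁ 0 N rfl, hn]
  · rw [f₂ 0 K rfl, f₁ 0 K rfl, hk]
  · have hB : ∀ i, vecAt τ₃ Bas n i = vecAt σ Bas n i := fun i => vecAt_congr fun j _ => by
      rw [f₃ Bas _ rfl, f₂ Bas _ rfl, f₁ Bas _ rfl]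
    have hC : coords τ₃ n = coords τ₂ n := coords_congr n fun m => f₃ Mat m rfl
    have hC' : coords τ₂ n = coords τ₁ n := coords_congr n fun m => f₂ Mat m rfl
    refine ⟨?_, ?_, ?_, ?_, ?_, h₃.2⟩
    · rw [f₃ 0 N rfl, f₂ 0 N rfl, f₁ 0 N rfl, hn]
    · rw [f₃ 0 K rfl, f₂ 0 K rfl, f₁ 0 K rfl, hk]
    · simpa only [hB] using hb
    · rw [funext hB, hC, hC']
      exact h₁
    · intro r hr
      have hK : vecAt τ₃ Keep n 0 = vecAt τ₂ Vec n 0 := by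
        rw [h₂]
        exact vecAt_congr fun j _ => by rw [f₃ Keep _ rfl, f₂ Keep _ rfl]
      rw [h₃.1 r hr, hK, hC, coords_vecAt]
      simp

theorem Clears.apply_eq_zero {E : Type*} [AddCommGroup E] [Module ℝ E]
    {f : E →ₗ[ℝ] (ℕ → ℝ)} {b : ℕ → E} {c n : ℕ} (h : Clears f b c n) {v : E}
    (hv : v ∈ Submodule.span ℝ (Set.range fun i : Fin c => b i)) {r : ℕ} (hr : r < n)
    (hcr : c ≤ r) : f v r = 0 := by
  obtain ⟨y, rfl⟩ := (Submodule.mem_span_range_iff_exists_fun ℝ).1 hv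
  simp only [map_sum, map_smul, Finset.sum_apply, Pi.smul_apply]
  refine sum_eq_zero fun i _ => ?_
  rw [h.2 i i.2 r hr, if_neg (by have := i.2; omega), smul_zero]

/-- The lattice generated by the basis and the vector in the array `a`. -/
def latticeAt (σ : Memory) (a n k : ℕ) : Submodule ℤ (EuclideanSpace ℝ (Fin n)) :=
  Submodule.span ℤ (insert (vecAt σ a n 0) (Set.range fun i : Fin k => vecAt σ Bas n i))

theorem vecAt_mem_latticeAt {σ : Memory} {a n k i : ℕ} (hi : i < k) :
    vecAt σ Bas n i ∈ latticeAt σ a n k :=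
  Submodule.subset_span (Set.mem_insert_of_mem _ ⟨⟨i, hi⟩, rfl⟩)

/-- `Piv = n` signals that no coordinate is bad, so that the vector in `Keep` is redundant and the
loop ends. A bad index below `k` calls for an exchange, any other for an append. -/
def insertLoop : Prog :=
  .loop (.lt (var Piv) (var N)) (.seq (.branch (.lt (var Piv) (var K)) swapStep appendStep) refresh)

/-- `m` counts the exchanges, each of which divides the Gram determinant by at least 4; `d` bounds
the exchanges still possible, since the determinant stays at least 1. The last clause is what allows
the cost of a call to be charged to its progress. -/
theorem insertLoop_runs {n k : ℕ} (d : ℕ) {σ : Memory} (hσ : Ready σ n k)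
    (hint : IsIntegral (latticeAt σ Keep n k))
    (hv : vecAt σ Keep n 0 ∈ Submodule.span ℝ (Set.range fun i : Fin k => vecAt σ Bas n i))
    (hd : gramDet (vecAt σ Bas n) k < 4 ^ d) :
    ∃ m : ℕ, Runs insertLoop σ (4000 * (n + 1) ^ 3 * m + 5) fun τ =>
      τ 0 K = k ∧ LinearIndependent ℝ (fun i : Fin k => vecAt τ Bas n i) ∧
      Submodule.span ℤ (Set.range fun i : Fin k => vecAt τ Bas n i) = latticeAt σ Keep n k ∧
      gramDet (vecAt τ Bas n) k * 4 ^ m ≤ gramDet (vecAt σ Bas n) k ∧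
      (m = 0 → vecAt σ Keep n 0 ∈
        Submodule.span ℤ (Set.range fun i : Fin k => vecAt σ Bas n i)) := by
  induction d generalizing σ with
  | zero =>
    have := one_le_gramDet hσ.li fun i hi j hj =>
      hint _ (vecAt_mem_latticeAt hi) _ (vecAt_mem_latticeAt hj)
    linarith
  | succ d ih =>
    rcases hσ.piv with ⟨hp, hgood⟩ | ⟨p, hpn, hp, hbad, -⟩
    · have hmem := (hσ.clears.mem_span_iff (le_of_linearIndependent hσ.li)
        (vecAt σ Keep n 0)).2 fun r hr => hσ.out r hr ▸ hgood r hr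
      refine ⟨0, Runs.loop_stop ?_ ⟨hσ.card, hσ.li, ?_, by simp, fun _ => hmem⟩⟩
      · simp [Test.Holds, hp, hσ.dim]
      · exact (Submodule.span_insert_eq_span hmem).symm
    -- In the real span all coordinates from `k` on vanish, so none of them is bad.
    · have hpk : p < k := by
        by_contra hcon
        rw [Bad, if_neg hcon, hσ.out p hpn] at hbad
        exact hbad (hσ.clears.apply_eq_zero hv hpn (by omega))
      rw [Bad, if_pos hpk] at hbad
      set x := σ Out p with hx
      set z := ⌊x + 1 / 2⌋ with hz
      obtain ⟨t₁, τ₁, he₁, ht₁, hK₁, hp₁, hi₁⟩ := swapStep_runs hσ.dim hp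
      have hf₁ : ∀ a m, swapStep.writes a m = false → τ₁ a m = σ a m := fun a m => he₁.frame
      -- The coordinates of the new `b_p` in the old basis.
      set y : ℕ → ℝ := fun i => coords σ n (vecAt σ Keep n 0) i - if i = p then (z : ℝ) else 0
        with hy
      have hyp : y p = x - z := by simp [hy, hx, hσ.out p hpn]
      have hsum : vecAt τ₁ Bas n p = ∑ i ∈ range k, y i • vecAt σ Bas n i := by
        have := hσ.clears.eq_sum (v := vecAt σ Keep n 0) fun r hr hkr =>
          hσ.clears.apply_eq_zero hv hr hkr
        rw [hp₁]
        nth_rewrite 1 [this]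
        simp only [hy, sub_smul, sum_sub_distrib, ite_smul, zero_smul, sum_ite_eq', mem_range, hpk,
          if_true, Int.cast_smul_eq_zsmul]
        rfl
      have hG := gramDet_update hpk y (fun i _ hi => hi₁ i hi) hsum
      -- The coordinate `x` is not an integer, so the exchange keeps the vectors independent.
      have hy0 : y p ≠ 0 := by
        rw [hyp]
        exact fun h => hbad z (by linarith)
      have hy4 : y p ^ 2 ≤ 1 / 4 := by
        have h1 : (z : ℝ) ≤ x + 1 / 2 := Int.floor_le _
        have h2 : x + 1 / 2 < z + 1 := Int.lt_floor_add_one _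
        rw [hyp]
        nlinarith
      have hGpos : 1 ≤ gramDet (vecAt σ Bas n) k := one_le_gramDet hσ.li fun i hi j hj =>
        hint _ (vecAt_mem_latticeAt hi) _ (vecAt_mem_latticeAt hj)
      have hG4 : gramDet (vecAt τ₁ Bas n) k * 4 ≤ gramDet (vecAt σ Bas n) k := by
        rw [hG]
        nlinarith
      have hli₁ : LinearIndependent ℝ fun i : Fin k => vecAt τ₁ Bas n i := by
        rw [← Matrix.det_gram_ne_zero_iff_linearIndependent]
        change gramDet (vecAt τ₁ Bas n) k ≠ 0
        rw [hG]
        positivity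
      have hlat₁ : latticeAt τ₁ Keep n k = latticeAt σ Keep n k := by
        rw [latticeAt, hK₁]
        exact span_insert_update hpk z (fun i _ hi => hi₁ i hi) hp₁
      have hn₁ : τ₁ 0 N = n := by rw [hf₁ 0 N rfl, hσ.dim]
      have hk₁ : τ₁ 0 K = k := by rw [hf₁ 0 K rfl, hσ.card]
      obtain ⟨t₂, τ₂, he₂, ht₂, hR⟩ := refresh_runs hn₁ hk₁ hli₁
      have hf₂ : ∀ a m, refresh.writes a m = false → τ₂ a m = τ₁ a m := fun a m => he₂.frame
      have hB₂ : ∀ i, vecAt τ₂ Bas n i = vecAt τ₁ Bas n i := fun i =>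
        vecAt_congr fun j _ => hf₂ Bas _ rfl
      have hK₂ : vecAt τ₂ Keep n 0 = vecAt τ₁ Keep n 0 := vecAt_congr fun j _ => hf₂ Keep _ rfl
      have hlat₂ : latticeAt τ₂ Keep n k = latticeAt σ Keep n k := by
        rw [← hlat₁, latticeAt, latticeAt, hK₂]
        simp only [hB₂]
      obtain ⟨m, hm⟩ := ih hR (hlat₂ ▸ hint)
        (by
          rw [hK₂, hK₁]
          simp only [hB₂]
          exact mem_span_of_update hpk y hy0 (fun i _ hi => hi₁ i hi) hsum)
        (by
          rw [funext hB₂]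
          rw [pow_succ] at hd
          linarith)
      refine ⟨m + 1, (Runs.loop_step (c := (5 + 100 * (n + 1)) + 3000 * (n + 1) ^ 3) ?_
        (Runs.seq (Runs.branch (fun _ => ⟨t₁, τ₁, he₁, ht₁, t₂, τ₂, he₂, ht₂, hm⟩)
        fun h => absurd ?_ h))).mono ?_ fun τ _ h => ?_⟩
      · simp only [Test.Holds, eval_var, hp, hσ.dim]
        exact_mod_cast hpn
      · simp only [Test.Holds, eval_var, hp, hσ.card]
        exact_mod_cast hpk
      · simp only [Test.cost, cost_var]; ring_nf; omega
      · obtain ⟨h1, h2, h3, h4, -⟩ := h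
        refine ⟨h1, h2, h3.trans hlat₂, ?_, fun h => absurd h (by omega)⟩
        rw [funext hB₂] at h4
        rw [pow_succ]
        linarith

theorem gramDet_lt_four_pow {n k : ℕ} (σ : Memory) :
    ∃ d : ℕ, gramDet (vecAt σ Bas n) k < 4 ^ d :=
  pow_unbounded_of_one_lt _ (by norm_num)

def insertVec : Prog := .seq refresh insertLoop

/-- `a` is 1 if the vector was appended and 0 otherwise, and `m` counts exchanges. The extra 1 in
the cost pays for the initial refresh, which is needed even if nothing happens. -/
theorem insertVec_runs {n k : ℕ} {σ : Memory} (hn : σ 0 N = n) (hk : σ 0 K = k)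
    (hb : LinearIndependent ℝ fun i : Fin k => vecAt σ Bas n i)
    (hint : IsIntegral (latticeAt σ Keep n k)) :
    ∃ m a : ℕ, Runs insertVec σ (4000 * (n + 1) ^ 3 * (m + a + 1)) fun τ =>
      τ 0 K = (k + a : ℕ) ∧ LinearIndependent ℝ (fun i : Fin (k + a) => vecAt τ Bas n i) ∧
      Submodule.span ℤ (Set.range fun i : Fin (k + a) => vecAt τ Bas n i) =
        latticeAt σ Keep n k ∧
      gramDet (vecAt τ Bas n) (k + a) * 4 ^ m ≤
        gramDet (vecAt σ Bas n) k * (‖vecAt σ Keep n 0‖ ^ 2) ^ a ∧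
      (m + a = 0 → vecAt σ Keep n 0 ∈
        Submodule.span ℤ (Set.range fun i : Fin k => vecAt σ Bas n i)) := by
  obtain ⟨t₁, τ₁, he₁, ht₁, hR₁⟩ := refresh_runs hn hk hb
  have hf₁ : ∀ a m, refresh.writes a m = false → τ₁ a m = σ a m := fun a m => he₁.frame
  have hB₁ : ∀ i, vecAt τ₁ Bas n i = vecAt σ Bas n i := fun i =>
    vecAt_congr fun j _ => hf₁ Bas _ rfl
  have hK₁ : vecAt τ₁ Keep n 0 = vecAt σ Keep n 0 := vecAt_congr fun j _ => hf₁ Keep _ rfl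
  have hlat₁ : latticeAt τ₁ Keep n k = latticeAt σ Keep n k := by
    rw [latticeAt, latticeAt, hK₁]
    simp only [hB₁]
  by_cases hv : vecAt τ₁ Keep n 0 ∈
      Submodule.span ℝ (Set.range fun i : Fin k => vecAt τ₁ Bas n i)
  · obtain ⟨d, hd⟩ := gramDet_lt_four_pow (n := n) (k := k) τ₁
    obtain ⟨m, hm⟩ := insertLoop_runs d hR₁ (hlat₁ ▸ hint) hv hd
    refine ⟨m, 0, (Runs.seq ⟨t₁, τ₁, he₁, ht₁, hm⟩).mono ?_ fun τ _ h => ?_⟩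
    · ring_nf; omega
    · obtain ⟨h1, h2, h3, h4, h5⟩ := h
      rw [hK₁] at h5
      rw [funext hB₁] at h4
      simp only [hB₁] at h5
      exact ⟨h1, h2, h3.trans hlat₁, by simpa using h4, fun h => h5 (by omega)⟩
  · rcases hR₁.piv with ⟨-, hgood⟩ | ⟨p, hpn, hp, hbad, hlast⟩
    · refine absurd ?_ hv
      have := (hR₁.clears.mem_span_iff (le_of_linearIndependent hR₁.li)
        (vecAt τ₁ Keep n 0)).2 fun r hr => hR₁.out r hr ▸ hgood r hr
      exact Submodule.span_subset_span ℤ ℝ _ this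
    -- `p` is the last bad index; were it below `k`, all coordinates from `k` on would vanish and
    -- the vector would lie in the real span.
    have hkp : ¬ p < k := by
      intro hpk
      refine hv ?_
      rw [hR₁.clears.eq_sum (v := vecAt τ₁ Keep n 0) fun r hr hkr => ?_]
      · exact Submodule.sum_mem _ fun i hi => Submodule.smul_mem _ _
          (Submodule.subset_span ⟨⟨i, mem_range.1 hi⟩, rfl⟩)
      · have := hlast r hr (by omega)
        rw [Bad, if_neg (by omega), hR₁.out r hr] at this
        exact not_not.1 this
    obtain ⟨t₂, τ₂, he₂, ht₂, hk₂, hv₂, hi₂⟩ := appendStep_runs hR₁.dim hR₁.card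
    have hf₂ : ∀ a m, appendStep.writes a m = false → τ₂ a m = τ₁ a m := fun a m => he₂.frame
    have hB₂ : ∀ i < k, vecAt τ₂ Bas n i = vecAt τ₁ Bas n i := fun i hi => hi₂ i hi.ne
    have hli' : LinearIndependent ℝ fun i : Fin k => vecAt τ₂ Bas n i := by
      convert hR₁.li using 2 with i
      exact hB₂ i i.2
    have hli₂ : LinearIndependent ℝ fun i : Fin (k + 1) => vecAt τ₂ Bas n i := by
      have : (fun i : Fin (k + 1) => vecAt τ₂ Bas n i) =
          Fin.snoc (fun i : Fin k => vecAt τ₁ Bas n i) (vecAt τ₁ Keep n 0) := by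
        funext i
        refine Fin.lastCases ?_ (fun i => ?_) i
        · simpa using hv₂
        · simpa using hB₂ i i.2
      rw [this, linearIndependent_finSnoc]
      exact ⟨hR₁.li, hv⟩
    have hn₂ : τ₂ 0 N = n := by rw [hf₂ 0 N rfl, hR₁.dim]
    obtain ⟨t₃, τ₃, he₃, ht₃, hR₃⟩ := refresh_runs hn₂ hk₂ hli₂
    have hf₃ : ∀ a m, refresh.writes a m = false → τ₃ a m = τ₂ a m := fun a m => he₃.frame
    have hB₃ : ∀ i, vecAt τ₃ Bas n i = vecAt τ₂ Bas n i := fun i =>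
      vecAt_congr fun j _ => hf₃ Bas _ rfl
    have hK₃ : vecAt τ₃ Keep n 0 = vecAt τ₁ Keep n 0 := vecAt_congr fun j _ => by
      rw [hf₃ Keep _ rfl, hf₂ Keep _ rfl]
    have hrange : Set.range (fun i : Fin (k + 1) => vecAt τ₃ Bas n i) =
        insert (vecAt τ₁ Keep n 0) (Set.range fun i : Fin k => vecAt τ₁ Bas n i) := by
      ext w
      simp only [Set.mem_insert_iff, Set.mem_range, hB₃]
      constructor
      · rintro ⟨i, rfl⟩
        refine Fin.lastCases ?_ (fun i => ?_) i
        · exact Or.inl hv₂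
        · exact Or.inr ⟨i, (hB₂ i i.2).symm⟩
      · rintro (rfl | ⟨i, rfl⟩)
        · exact ⟨Fin.last k, hv₂⟩
        · exact ⟨i.castSucc, hB₂ i i.2⟩
    have hlat₃ : latticeAt τ₃ Keep n (k + 1) = latticeAt σ Keep n k := by
      rw [← hlat₁, latticeAt, hrange, hK₃, Set.insert_eq_of_mem (Set.mem_insert _ _)]
      rfl
    obtain ⟨d, hd⟩ := gramDet_lt_four_pow (n := n) (k := k + 1) τ₃
    -- The appended vector stays in `Keep` but is now also in the basis, so the lattice is unchanged
    -- and the case inside the real span applies with `k + 1`.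
    obtain ⟨m, hm⟩ := insertLoop_runs d hR₃ (hlat₃ ▸ hint)
      (by
        rw [hrange, hK₃]
        exact Submodule.subset_span (Set.mem_insert _ _)) hd
    refine ⟨m, 1, (Runs.seq ⟨t₁, τ₁, he₁, ht₁, Runs.loop_step
      (c := (5 + 100 * (n + 1)) + 3000 * (n + 1) ^ 3) ?_
      (Runs.seq (Runs.branch (fun h => absurd h ?_)
        fun _ => ⟨t₂, τ₂, he₂, ht₂, t₃, τ₃, he₃, ht₃, hm⟩))⟩).mono ?_ fun τ _ h => ?_⟩
    · simp only [Test.Holds, eval_var, hp, hR₁.dim]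
      exact_mod_cast hpn
    · simp only [Test.Holds, eval_var, hp, hR₁.card]
      exact_mod_cast hkp
    · simp only [Test.cost, cost_var]; ring_nf; omega
    · obtain ⟨h1, h2, h3, h4, -⟩ := h
      refine ⟨h1, h2, h3.trans hlat₃, h4.trans ?_, fun h => absurd h (by omega)⟩
      rw [funext hB₃, pow_one]
      refine (gramDet_succ_le hli').trans (le_of_eq ?_)
      have : gramDet (vecAt τ₂ Bas n) k = gramDet (vecAt σ Bas n) k := by
        unfold gramDet
        congr 2
        funext i
        rw [hB₂ i i.2, hB₁]
      rw [this, hv₂, hK₁]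

/-- The embedding of the arrays of `constructBasisBody` into the memory of the calling program:
arrays `6` and `7` give access to the vector and the scalars of the caller, the basis is shared,
and all other arrays are workspace. -/
def embedArray (a : ℕ) : ℕ :=
  if a = 2 then 2 else if a = 6 then 3 else if a = 7 then 0 else a + 6

theorem embedArray_injective : Function.Injective embedArray := by
  intro a b h
  unfold embedArray at h
  split_ifs at h <;> omega

/-- Works on copies of `n`, `k` and the vector. The vector needs one because exchanges overwrite
`Keep`; of the caller's scalars only `k` is written back. -/
def constructBasisBody : Prog :=
  block [setVar N (.get 7 (.lit N)), setVar K (.get 7 (.lit K)), copyVec 6 Keep, insertVec,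
    .assign 7 (.lit K) (var K)]

/-- The subroutine: while the vector is not in the lattice generated by the basis, either append it
to the basis, or replace a basis vector so that the Gram determinant drops. -/
def constructBasis : Prog := constructBasisBody.rename embedArray

theorem constructBasisBody_runs {n k : ℕ} {σ : Memory} (hn : σ 7 N = n) (hk : σ 7 K = k)
    (hb : LinearIndependent ℝ fun i : Fin k => vecAt σ Bas n i)
    (hint : IsIntegral (latticeAt σ 6 n k)) :
    ∃ m a : ℕ, Runs constructBasisBody σ (5000 * (n + 1) ^ 3 * (m + a + 1)) fun τ =>
      τ 7 K = (k + a : ℕ) ∧ LinearIndependent ℝ (fun i : Fin (k + a) => vecAt τ Bas n i) ∧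
      Submodule.span ℤ (Set.range fun i : Fin (k + a) => vecAt τ Bas n i) =
        latticeAt σ 6 n k ∧
      gramDet (vecAt τ Bas n) (k + a) * 4 ^ m ≤
        gramDet (vecAt σ Bas n) k * (‖vecAt σ 6 n 0‖ ^ 2) ^ a ∧
      (m + a = 0 → vecAt σ 6 n 0 ∈
        Submodule.span ℤ (Set.range fun i : Fin k => vecAt σ Bas n i)) := by
  obtain ⟨τ₁, h₁⟩ : ∃ τ₁, τ₁ = write (write σ 0 N ((Expr.get 7 (.lit N)).eval σ)) 0 K
    ((Expr.get 7 (.lit K)).eval (write σ 0 N ((Expr.get 7 (.lit N)).eval σ))) := ⟨_, rfl⟩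
  have hn₁ : τ₁ 0 N = n := by
    rw [h₁, write_apply, if_neg (by decide), write_apply, if_pos ⟨rfl, rfl⟩]
    simp [Expr.eval, hn]
  have hk₁ : τ₁ 0 K = k := by
    rw [h₁, write_apply, if_pos ⟨rfl, rfl⟩]
    simp [Expr.eval, write_apply, hk]
  have ha₁ : ∀ a ≠ 0, ∀ m, τ₁ a m = σ a m := fun a ha m => by
    rw [h₁, write_apply, if_neg (by simp [ha]), write_apply, if_neg (by simp [ha])]
  obtain ⟨t₂, τ₂, he₂, ht₂, hK₂⟩ := copyVec_runs (a := 6) (a' := Keep) hn₁ (by decide) (by decide)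
    (by decide)
  have hf₂ : ∀ a m, (copyVec 6 Keep).writes a m = false → τ₂ a m = τ₁ a m :=
    fun a m => he₂.frame
  have hB₂ : ∀ i, vecAt τ₂ Bas n i = vecAt σ Bas n i := fun i => vecAt_congr fun j _ => by
    rw [hf₂ Bas _ rfl, ha₁ _ (by decide)]
  have hK : vecAt τ₂ Keep n 0 = vecAt σ 6 n 0 := by
    rw [hK₂]
    exact vecAt_congr fun j _ => ha₁ _ (by decide) _
  have hlat : latticeAt τ₂ Keep n k = latticeAt σ 6 n k := by
    rw [latticeAt, latticeAt, hK]
    simp only [hB₂]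
  obtain ⟨m, a, t₃, τ₃, he₃, ht₃, h₃⟩ := insertVec_runs (n := n) (k := k) (σ := τ₂)
    (by rw [hf₂ 0 N rfl, hn₁]) (by rw [hf₂ 0 K rfl, hk₁]) (by simpa only [hB₂] using hb)
    (hlat ▸ hint)
  refine ⟨m, a, Runs.weaken (c := 4 + (4 + (30 * (n + 1) + (4000 * (n + 1) ^ 3 * (m + a + 1) +
    (4 + 0))))) (Runs.block_cons (Runs.weaken (Runs.setVar (Runs.block_cons (Runs.weaken
    (Runs.setVar (Runs.block_cons ?_)) le_rfl))) le_rfl)) ?_⟩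
  · rw [← h₁]
    refine ⟨t₂, τ₂, he₂, ht₂, Runs.block_cons ⟨t₃, τ₃, he₃, ht₃, Runs.block_cons
      (Runs.weaken (Runs.assign (Runs.block_nil ?_)) (by simp [Expr.cost]))⟩⟩
    have hB : ∀ x, vecAt (write τ₃ 7 ⌊(Expr.lit K).eval τ₃⌋₊ ((var K).eval τ₃)) Bas n x =
        vecAt τ₃ Bas n x := fun x => vecAt_congr fun j _ => by
      rw [write_apply, if_neg (by simp [Bas])]
    obtain ⟨g1, g2, g3, g4, g5⟩ := h₃
    rw [hlat] at g3
    rw [hK, funext hB₂] at g4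
    simp only [hB₂, hK] at g5
    refine ⟨?_, ?_, ?_, ?_, g5⟩
    · simp [write_apply, Expr.eval, g1]
    · simpa only [hB] using g2
    · simpa only [hB] using g3
    · rwa [funext hB]
  · have h1 : (n + 1) ^ 3 * 1 ≤ (n + 1) ^ 3 * (m + a + 1) := Nat.mul_le_mul_left _ (by omega)
    have h2 : 12 + 30 * (n + 1) ≤ 1000 * ((n + 1) ^ 3 * 1) := by ring_nf; omega
    calc _ = 12 + 30 * (n + 1) + 4000 * ((n + 1) ^ 3 * (m + a + 1)) := by ring
      _ ≤ 1000 * ((n + 1) ^ 3 * (m + a + 1)) + 4000 * ((n + 1) ^ 3 * (m + a + 1)) := by omega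
      _ = _ := by ring

theorem constructBasis_runs {n k : ℕ} {σ : Memory} (hn : σ 0 N = n) (hk : σ 0 K = k)
    (hb : LinearIndependent ℝ fun i : Fin k => vecAt σ Bas n i)
    (hint : IsIntegral (latticeAt σ Vec n k)) :
    ∃ m a : ℕ, Runs constructBasis σ (5000 * (n + 1) ^ 3 * (m + a + 1)) fun τ =>
      τ 0 K = (k + a : ℕ) ∧ LinearIndependent ℝ (fun i : Fin (k + a) => vecAt τ Bas n i) ∧
      Submodule.span ℤ (Set.range fun i : Fin (k + a) => vecAt τ Bas n i) =
        latticeAt σ Vec n k ∧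
      gramDet (vecAt τ Bas n) (k + a) * 4 ^ m ≤
        gramDet (vecAt σ Bas n) k * (‖vecAt σ Vec n 0‖ ^ 2) ^ a ∧
      (m + a = 0 → vecAt σ Vec n 0 ∈
        Submodule.span ℤ (Set.range fun i : Fin k => vecAt σ Bas n i)) ∧
      ∀ a m : ℕ, a < 6 → a ≠ Bas → ¬ (a = 0 ∧ m = K) → τ a m = σ a m := by
  obtain ⟨m, a, h⟩ := constructBasisBody_runs (σ := fun a => σ (embedArray a)) hn hk hb hint
  have h' := (h.mono le_rfl (Q' := fun τ => _ ∧ _) fun τ f h => ⟨f, h⟩).rename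
    embedArray_injective
  refine ⟨m, a, h'.mono le_rfl fun τ _ hτ => ?_⟩
  obtain ⟨⟨hf, h1, h2, h3, h4, h5⟩, hr⟩ := hτ
  refine ⟨h1, h2, h3, h4, h5, fun a m ha hab hK => ?_⟩
  -- Arrays 1, 4 and 5 are outside the range of `embedArray`. Arrays 0 and 3 are images of 7 and 6,
  -- and there the frame of the body applies: it writes only cell `K` of array 7, and nothing in
  -- array 6.
  have hne : ∀ a, a = 1 ∨ a = 4 ∨ a = 5 → τ a = σ a := by
    intro a ha
    refine hr a ?_
    rintro ⟨x, hx⟩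
    unfold embedArray at hx
    split_ifs at hx <;> omega
  interval_cases a
  · refine hf 7 m ?_
    have hmK : m ≠ 2 := fun h => hK ⟨rfl, h⟩
    change (decide (m = 2) || false) = false
    simp [hmK]
  · rw [hne 1 (by simp)]
  · exact absurd rfl hab
  · exact hf 6 m rfl
  · rw [hne 4 (by simp)]
  · rw [hne 5 (by simp)]

theorem constructsBasis_constructBasis : ConstructsBasis constructBasis := by
  intro n k σ hn hk hb hint
  obtain ⟨m, a, t, τ, he, -, h1, h2, h3, -, -, h6⟩ := constructBasis_runs hn hk hb hint
  exact ⟨t, τ, k + a, he, h1, h2, h3, h6⟩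

/-! ### The main loop -/

section Main

variable {n s : ℕ} (v : Fin s → EuclideanSpace ℝ (Fin n)) (B : ℝ)

/-- The invariant of the main loop after `i` generators and `u` operations. -/
def SieveInv (i u : ℕ) (τ : Memory) : Prop :=
  ∃ k m : ℕ, τ 0 K = k ∧ LinearIndependent ℝ (fun j : Fin k => vecAt τ Bas n j) ∧
    Clears (coords τ n) (vecAt τ Bas n) k n ∧
    Submodule.span ℤ (Set.range fun j : Fin k => vecAt τ Bas n j) =
      Submodule.span ℤ (v '' {j | j.1 < i}) ∧
    gramDet (vecAt τ Bas n) k * 4 ^ m ≤ (B ^ 2) ^ k ∧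
    u ≤ 20000 * (n + 1) ^ 3 * (k + m) + 300 * (n + 1) ^ 2 * i

def sieveStep : Prog :=
  block
    [fetch Gens I, sieveTest,
     .branch (.eq (var Flag) (.lit 0)) (.seq constructBasis updateInverse) .skip]

theorem sieveBasis_eq :
    sieveBasis constructBasis =
      block [setVar K (.lit 0), setOne, forLoop I (var S) sieveStep] := rfl

variable {v B}

/-- Amortization: the cubic cost of a call is charged to the increase of `k + m`, the quadratic cost
of fetching and testing to the generator. -/
theorem sieveStep_runs {i : ℕ} (hi : i < s) {τ : Memory} (hn : τ 0 N = n) (hI : τ 0 I = i)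
    (hg : vecAt τ Gens n i = v ⟨i, hi⟩)
    (hint : IsIntegral (Submodule.span ℤ (Set.range v))) (hB : ∀ i, ‖v i‖ ≤ B) {u : ℕ}
    (hinv : SieveInv v B i u τ) : ∃ t, Runs sieveStep τ t (SieveInv v B (i + 1) (u + t)) := by
  obtain ⟨k, m, hk, hli, hcl, hspan, hG, hu⟩ := hinv
  obtain ⟨t₁, τ₁, he₁, ht₁, h₁⟩ := fetch_runs hn hI (by decide) (a := Gens) (by decide) (by decide)
  have hf₁ : ∀ a m, (fetch Gens I).writes a m = false → τ₁ a m = τ a m := fun a m => he₁.frame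
  have hn₁ : τ₁ 0 N = n := by rw [hf₁ 0 N rfl, hn]
  have hk₁ : τ₁ 0 K = k := by rw [hf₁ 0 K rfl, hk]
  obtain ⟨t₂, τ₂, he₂, ht₂, h₂⟩ := sieveTest_runs hn₁ hk₁
  have hf₂ : ∀ a m, sieveTest.writes a m = false → τ₂ a m = τ₁ a m := fun a m => he₂.frame
  have hn₂ : τ₂ 0 N = n := by rw [hf₂ 0 N rfl, hn₁]
  have hk₂ : τ₂ 0 K = k := by rw [hf₂ 0 K rfl, hk₁]
  have hv₁ : vecAt τ₁ Vec n 0 = v ⟨i, hi⟩ := by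
    rw [← hg]
    exact vecAt_congr fun j hj => by rw [zero_mul, zero_add, h₁ j hj]
  have hv₂ : vecAt τ₂ Vec n 0 = v ⟨i, hi⟩ := by
    rw [← hv₁]
    exact vecAt_congr fun j _ => hf₂ Vec _ rfl
  have hB₂ : ∀ x, vecAt τ₂ Bas n x = vecAt τ Bas n x := fun x => vecAt_congr fun j _ => by
    rw [hf₂ Bas _ rfl, hf₁ Bas _ rfl]
  have hC₁ : coords τ₁ n = coords τ n := coords_congr n fun m => hf₁ Mat m rfl
  have hC₂ : coords τ₂ n = coords τ₁ n := coords_congr n fun m => hf₂ Mat m rfl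
  have hflag : τ₂ 0 Flag = 0 ↔ v ⟨i, hi⟩ ∉
      Submodule.span ℤ (Set.range fun j : Fin k => vecAt τ Bas n j) := by
    rw [h₂, hcl.mem_span_iff (le_of_linearIndependent hli), ← hv₁, ← hC₁]
    push Not
    refine exists_congr fun r => and_congr_right fun _ => ?_
    rw [coords_vecAt, zero_mul]
    simp only [zero_add]
  have himage : v '' {j | j.1 < i + 1} = insert (v ⟨i, hi⟩) (v '' {j | j.1 < i}) := by
    rw [← Set.image_insert_eq]
    congr 1
    ext j
    simp only [Set.mem_ofPred_eq, Set.mem_insert_iff, Fin.ext_iff]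
    omega
  have hinsert : Submodule.span ℤ (v '' {j | j.1 < i + 1}) = Submodule.span ℤ
      (insert (v ⟨i, hi⟩) (Set.range fun j : Fin k => vecAt τ Bas n j)) := by
    rw [himage, Submodule.span_insert, Submodule.span_insert, hspan]
  have hlat : latticeAt τ₂ Vec n k = Submodule.span ℤ (v '' {j | j.1 < i + 1}) := by
    rw [latticeAt, hv₂, hinsert]
    simp only [hB₂]
  by_cases hfl : τ₂ 0 Flag = 0
  · have hint₂ : IsIntegral (latticeAt τ₂ Vec n k) := by
      rw [hlat]
      have hle := Submodule.span_mono (R := ℤ) (Set.image_subset_range v {j | j.1 < i + 1})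
      exact fun x hx y hy => hint x (hle hx) y (hle hy)
    have hli₂ : LinearIndependent ℝ fun j : Fin k => vecAt τ₂ Bas n j := by
      simpa only [hB₂] using hli
    obtain ⟨m', a, t₃, τ₃, he₃, ht₃, hk₃, hli₃, hspan₃, hG₃, h0, hf₃⟩ :=
      constructBasis_runs hn₂ hk₂ hli₂ hint₂
    have hn₃ : τ₃ 0 N = n := by
      rw [hf₃ 0 N (by decide) (by decide) (by decide), hn₂]
    obtain ⟨t₄, τ₄, he₄, ht₄, hcl₄⟩ := updateInverse_runs hn₃ hk₃ hli₃
    have hf₄ : ∀ a m, updateInverse.writes a m = false → τ₄ a m = τ₃ a m :=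
      fun a m => he₄.frame
    have hB₄ : ∀ x, vecAt τ₄ Bas n x = vecAt τ₃ Bas n x := fun x => vecAt_congr fun j _ =>
      hf₄ Bas _ rfl
    -- The sieve rejected membership, so the call makes progress; hence `m' + a + 1 ≤ 2 (m' + a)`
    -- absorbs the overhead of the call.
    have hma : 1 ≤ m' + a := by
      by_contra hcon
      have := h0 (by omega)
      rw [hv₂] at this
      simp only [hB₂] at this
      exact hflag.1 hfl this
    refine ⟨t₁ + (t₂ + (4 + (t₃ + t₄))), Runs.weaken (Runs.block_cons
      ⟨t₁, τ₁, he₁, le_rfl, Runs.block_cons ⟨t₂, τ₂, he₂, le_rfl, Runs.block_cons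
        (c := 4 + (t₃ + t₄)) (c' := 0) (Runs.branch (fun _ => Runs.seq ⟨t₃, τ₃, he₃, le_rfl, t₄, τ₄,
          he₄, le_rfl, Runs.block_nil ?_⟩) fun h => absurd ?_ h)⟩⟩) (by omega)⟩
    · refine ⟨k + a, m + m', ?_, ?_, ?_, ?_, ?_, ?_⟩
      · rw [hf₄ 0 K rfl, hk₃]
      · simpa only [hB₄] using hli₃
      · rwa [funext hB₄]
      · simp only [hB₄]
        rw [hspan₃, hlat]
      · rw [funext hB₄]
        have hvB : ‖vecAt τ₂ Vec n 0‖ ^ 2 ≤ B ^ 2 := by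
          rw [hv₂]
          exact pow_le_pow_left₀ (norm_nonneg _) (hB _) 2
        have hGk : gramDet (vecAt τ₂ Bas n) k = gramDet (vecAt τ Bas n) k := by
          rw [funext hB₂]
        calc gramDet (vecAt τ₃ Bas n) (k + a) * 4 ^ (m + m')
            = gramDet (vecAt τ₃ Bas n) (k + a) * 4 ^ m' * 4 ^ m := by ring
          _ ≤ gramDet (vecAt τ₂ Bas n) k * (‖vecAt τ₂ Vec n 0‖ ^ 2) ^ a * 4 ^ m := by gcongr
          _ = gramDet (vecAt τ Bas n) k * 4 ^ m * (‖vecAt τ₂ Vec n 0‖ ^ 2) ^ a := by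
            rw [hGk]; ring
          _ ≤ (B ^ 2) ^ k * (B ^ 2) ^ a := by gcongr
          _ = (B ^ 2) ^ (k + a) := (pow_add _ _ _).symm
      · have e1 : t₃ ≤ 10000 * ((n + 1) ^ 3 * (m' + a)) := by
          refine ht₃.trans ?_
          have : (n + 1) ^ 3 * (m' + a + 1) ≤ (n + 1) ^ 3 * (2 * (m' + a)) :=
            Nat.mul_le_mul_left _ (by omega)
          nlinarith
        have e2 : t₄ ≤ 2000 * ((n + 1) ^ 3 * (m' + a)) := by
          refine ht₄.trans ?_
          have : (n + 1) ^ 3 * 1 ≤ (n + 1) ^ 3 * (m' + a) := Nat.mul_le_mul_left _ hma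
          omega
        have e3 : t₁ + t₂ + 5 ≤ 300 * (n + 1) ^ 2 := by
          have : 30 * (n + 1) + 5 ≤ 100 * (n + 1) ^ 2 := by ring_nf; omega
          omega
        calc u + (t₁ + (t₂ + (4 + (t₃ + t₄))))
            ≤ (20000 * (n + 1) ^ 3 * (k + m) + 300 * (n + 1) ^ 2 * i) +
              (300 * (n + 1) ^ 2 + 20000 * ((n + 1) ^ 3 * (m' + a))) := by omega
          _ = _ := by ring
    · simpa [Test.Holds, Expr.eval] using hfl
  · have hmem := not_not.1 (fun h => hfl (hflag.2 h))
    refine ⟨t₁ + (t₂ + 4), Runs.weaken (Runs.block_cons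
      ⟨t₁, τ₁, he₁, le_rfl, Runs.block_cons ⟨t₂, τ₂, he₂, le_rfl, Runs.block_cons
        (c := 4) (c' := 0) (Runs.branch (c := 0) (fun h => absurd ?_ hfl) fun _ =>
          Runs.skip (Runs.block_nil ?_))⟩⟩) (by omega)⟩
    · simpa [Test.Holds, Expr.eval] using h
    · refine ⟨k, m, hk₂, ?_, ?_, ?_, ?_, ?_⟩
      · simpa only [hB₂] using hli
      · rwa [funext hB₂, hC₂, hC₁]
      · rw [hinsert, Submodule.span_insert_eq_span hmem]
        simp only [hB₂]
      · rwa [funext hB₂]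
      · have e3 : t₁ + t₂ + 5 ≤ 300 * (n + 1) ^ 2 := by
          have : 30 * (n + 1) + 5 ≤ 100 * (n + 1) ^ 2 := by ring_nf; omega
          omega
        calc u + (t₁ + (t₂ + 4))
            ≤ (20000 * (n + 1) ^ 3 * (k + m) + 300 * (n + 1) ^ 2 * i) + 300 * (n + 1) ^ 2 := by
              omega
          _ = _ := by ring

theorem sieveBasis_runs {σ : Memory} (hσ : IsInput v σ)
    (hint : IsIntegral (Submodule.span ℤ (Set.range v))) (hB : ∀ i, ‖v i‖ ≤ B) :
    ∃ t, Runs (sieveBasis constructBasis) σ (t + (100 * (n + 1) ^ 2 + 11 * s + 14))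
      (SieveInv v B s t) := by
  obtain ⟨hn, hs, hv⟩ := hσ
  rw [sieveBasis_eq]
  set σ₁ := write σ 0 K 0 with hσ₁
  have ha₁ : ∀ a m, ¬ (a = 0 ∧ m = K) → σ₁ a m = σ a m := fun a m h => by
    rw [hσ₁, write_apply, if_neg h]
  obtain ⟨t₂, τ₂, he₂, ht₂, h₂⟩ := setOne_runs (σ := σ₁) (n := n)
    (by rw [ha₁ 0 N (by decide), hn])
  have hf₂ : ∀ a m, setOne.writes a m = false → τ₂ a m = σ₁ a m := fun a m => he₂.frame
  obtain ⟨t, ht⟩ := Runs.forLoop_amortized (x := I) (y := S) (P := sieveStep) (σ := τ₂) (n := s)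
    (SieveInv v B) (by rw [hf₂ 0 S rfl, ha₁ 0 S (by decide), hs]) (by decide) rfl rfl
    (by
      -- Initially `k = m = 0`: the empty Gram determinant is 1, and `A` is the identity.
      refine ⟨0, 0, ?_, linearIndependent_empty_type, ⟨fun x hx => ?_, by simp⟩, ?_, ?_, by simp⟩
      · rw [hf₂ 0 K rfl, hσ₁, write_apply, if_pos ⟨rfl, rfl⟩, Nat.cast_zero]
      · ext j
        rw [PiLp.zero_apply, ← hx j j.2, coords_apply, sum_eq_single j]
        · rw [h₂ j j.2 j j.2, if_pos rfl, one_mul]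
        · intro l _ hl
          rw [h₂ j j.2 l l.2, if_neg fun h => hl (Fin.ext h.symm), zero_mul]
        · simp
      · simp
      · simp [gramDet])
    (by
      rintro i u τ z ⟨k, m, h1, h2, h3, h4, h5, h6⟩
      have hb : ∀ x, vecAt (write τ 0 I z) Bas n x = vecAt τ Bas n x := fun x =>
        vecAt_congr fun j _ => by rw [write_apply, if_neg (by simp [Bas])]
      refine ⟨k, m, ?_, ?_, ?_, ?_, ?_, h6⟩
      · rw [write_apply, if_neg (by decide), h1]
      · simpa only [hb] using h2
      · rwa [funext hb, coords_congr (τ := write τ 0 I z) (σ := τ)]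
        exact fun m => by rw [write_apply, if_neg (by simp [Mat])]
      · simpa only [hb] using h4
      · rwa [funext hb])
    (by
      intro i hi u τ hfr hI hinv
      refine sieveStep_runs hi ?_ hI ?_ hint hB hinv
      · rw [hfr 0 N rfl (by decide), hf₂ 0 N rfl, ha₁ 0 N (by decide), hn]
      · rw [← hv ⟨i, hi⟩]
        exact vecAt_congr fun j _ => by
          rw [hfr Gens _ rfl (by simp [Gens]), hf₂ Gens _ rfl, ha₁ _ _ (by simp [Gens])])
  refine ⟨t, Runs.weaken (c := 3 + (100 * (n + 1) ^ 2 + (t + 11 * (s + 1) + 0))) (Runs.block_cons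
    (Runs.weaken (Runs.setVar (Runs.block_cons ⟨t₂, τ₂, ?_, ht₂, Runs.block_cons (ht.mono le_rfl
      fun τ _ h => Runs.block_nil h)⟩)) (by simp [Expr.cost]))) (by omega)⟩
  simpa [Expr.eval] using he₂

end Main

/-! ### Correctness of the output and the final estimate. -/

/-- A spanning linearly independent family in the memory is a basis of a lattice of full rank. -/
theorem isOutput_of_span_eq {n k : ℕ} {τ : Memory}
    {L : Submodule ℤ (EuclideanSpace ℝ (Fin n))} [DiscreteTopology L] [IsZLattice ℝ L]
    (hk : τ 0 K = k) (hli : LinearIndependent ℝ fun j : Fin k => vecAt τ Bas n j)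
    (hspan : Submodule.span ℤ (Set.range fun j : Fin k => vecAt τ Bas n j) = L) :
    k = n ∧ IsOutput L τ := by
  have htop : Submodule.span ℝ (Set.range fun j : Fin k => vecAt τ Bas n j) = ⊤ := by
    rw [← Submodule.span_span_of_tower ℤ, hspan]
    exact IsZLattice.span_top
  have hkn : k = n := by
    have := finrank_span_eq_card hli
    rw [htop, finrank_top] at this
    simpa using this.symm
  subst hkn
  refine ⟨rfl, hk, ?_⟩
  have hliZ : LinearIndependent ℤ fun j : Fin k => vecAt τ Bas k j :=
    hli.restrict_scalars (by
      intro a b h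
      simpa using h)
  have hbasis : ∃ b : Module.Basis (Fin k) ℤ
      (Submodule.span ℤ (Set.range fun j : Fin k => vecAt τ Bas k j)),
      ∀ i, (b i : EuclideanSpace ℝ (Fin k)) = vecAt τ Bas k i :=
    ⟨Module.Basis.span hliZ, fun i => by rw [Module.Basis.span_apply]⟩
  rwa [hspan] at hbasis

/-- Taking logarithms in `hm` gives `m ≤ 2 n l`. If `l` is bounded below, both `n` and `m` are
absorbed by `n l²`. Since `l` may vanish, the remaining case needs the term `s n²`. -/
theorem operations_le {n m s : ℕ} {B : ℝ} (hn : 1 ≤ n) (hB : 1 ≤ B) (hs : 1 ≤ s)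
    (hm : (4 : ℝ) ^ m ≤ (B ^ 2) ^ n) :
    ((n + m : ℕ) : ℝ) * n ^ 3 ≤ 24 * (n ^ 6 * Real.log (n * B) ^ 2) + s * n ^ 2 := by
  have hn' : (1 : ℝ) ≤ n := by exact_mod_cast hn
  have hs' : (1 : ℝ) ≤ s := by exact_mod_cast hs
  set l := Real.log (n * B) with hl
  by_cases h2 : 2 ≤ ((n : ℝ) * B) ^ 2
  · have hlog2 := Real.log_two_gt_d9
    -- `2 l ≥ log 2 > 1/2`. With `n ≤ 4 n l` and `m ≤ 2 n l` this gives `n + m ≤ 6 n l ≤ 24 n l²`.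
    have hl4 : 1 / 4 ≤ l := by
      have := Real.log_le_log (by norm_num) h2
      rw [Real.log_pow] at this
      push_cast at this
      linarith
    have hml : (m : ℝ) ≤ 2 * (n * l) := by
      have h := Real.log_le_log (by positivity) hm
      have hBl : Real.log B ≤ l := Real.log_le_log (by linarith) (by nlinarith)
      rw [Real.log_pow, Real.log_pow, Real.log_pow, show (4 : ℝ) = 2 ^ 2 by norm_num,
        Real.log_pow] at h
      push_cast at h
      have h3 : (n : ℝ) * Real.log B ≤ n * l := by gcongr
      have h4 : (m : ℝ) * Real.log 2 ≤ n * l := by linarith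
      nlinarith [Nat.cast_nonneg (α := ℝ) m]
    have h1 : ((n + m : ℕ) : ℝ) ≤ 24 * (n * l ^ 2) := by
      push_cast
      have : (n : ℝ) ≤ 4 * (n * l) := by nlinarith
      have : (n : ℝ) * l ≤ 4 * (n * l ^ 2) := by nlinarith
      linarith
    calc ((n + m : ℕ) : ℝ) * n ^ 3 ≤ 24 * (n * l ^ 2) * n ^ 3 := by gcongr
      _ = 24 * (n ^ 4 * l ^ 2) := by ring
      _ ≤ 24 * (n ^ 6 * l ^ 2) := by gcongr; norm_num
      _ ≤ _ := le_add_of_nonneg_right (by positivity)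
  -- As `B ≥ 1`, a small `n B` forces `n = 1`; then `4 ^ m ≤ B² < 2` forces `m = 0`, and the left
  -- side is 1.
  · have hn1 : n = 1 := by
      by_contra hne
      have : (2 : ℝ) ≤ n := by exact_mod_cast (by omega : 2 ≤ n)
      have : (2 : ℝ) ≤ n * B := by nlinarith
      exact h2 (by nlinarith)
    subst hn1
    have hm0 : m = 0 := by
      by_contra hne
      have : (4 : ℝ) ^ 1 ≤ 4 ^ m := pow_le_pow_right₀ (by norm_num) (by omega)
      simp only [Nat.cast_one, one_mul, pow_one] at h2 this hm
      linarith
    subst hm0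
    have : 0 ≤ l ^ 2 := sq_nonneg l
    simp
    linarith

end RealRam

theorem mainTheorem4 :
    ∃ constructBasis : RealRam.Prog, RealRam.ConstructsBasis constructBasis ∧
      ∃ C : ℝ, ∀ (n s : ℕ) (B : ℝ) (L : Submodule ℤ (EuclideanSpace ℝ (Fin n)))
        [DiscreteTopology L] [IsZLattice ℝ L] (v : Fin s → EuclideanSpace ℝ (Fin n))
        (σ : RealRam.Memory),
        1 ≤ n → RealRam.IsIntegral L → Submodule.span ℤ (Set.range v) = L →
        (∀ i, ‖v i‖ ≤ B) → RealRam.IsInput v σ →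
        ∃ (t : ℕ) (τ : RealRam.Memory),
          RealRam.Exec (RealRam.sieveBasis constructBasis) σ t τ ∧
          RealRam.IsOutput L τ ∧
          (t : ℝ) ≤ C * ((n : ℝ) ^ 6 * Real.log (n * B) ^ 2 + (s : ℝ) * (n : ℝ) ^ 2) := by
  -- Any constant from `160000 * 24` on would do, by `ht''` and `operations_le` below.
  refine ⟨RealRam.constructBasis, RealRam.constructsBasis_constructBasis, 4010000, ?_⟩
  intro n s B L _ _ v σ hn hint hL hB hσ
  obtain ⟨u, t, τ, he, ht, k, m, hk, hli, -, hspan, hG, hu⟩ :=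
    RealRam.sieveBasis_runs hσ (hL ▸ hint) hB
  have huniv : v '' {j | j.1 < s} = Set.range v := by
    rw [← Set.image_univ]
    congr 1
    ext j
    simp
  rw [huniv, hL] at hspan
  -- The substitution eliminates `n`; from here on `k` is the dimension.
  obtain ⟨rfl, hout⟩ := RealRam.isOutput_of_span_eq hk hli hspan
  refine ⟨t, τ, he, hout, ?_⟩
  have hmem : ∀ i < k, RealRam.vecAt τ RealRam.Bas k i ∈ L := fun i hi => by
    rw [← hspan]
    exact Submodule.subset_span ⟨⟨i, hi⟩, rfl⟩
  have hG1 := RealRam.one_le_gramDet hli fun i hi j hj =>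
    hint _ (hmem i hi) _ (hmem j hj)
  have hs : 1 ≤ s := by
    by_contra hcon
    obtain rfl : s = 0 := by omega
    have h0 := hmem 0 hn
    rw [← hL, Set.range_eq_empty, Submodule.span_empty, Submodule.mem_bot] at h0
    exact hli.ne_zero ⟨0, hn⟩ h0
  have hB0 : 0 ≤ B := (norm_nonneg _).trans (hB ⟨0, hs⟩)
  have h4 : (4 : ℝ) ^ m ≤ (B ^ 2) ^ k :=
    (le_mul_of_one_le_left (by positivity) hG1).trans hG
  -- `1 ≤ 4 ^ m ≤ B ^ (2 k)` with `k ≥ 1`.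
  have hB1 : 1 ≤ B := by
    by_contra hcon
    have h1 : B ^ 2 < 1 := by nlinarith
    have h2 : (B ^ 2) ^ k < 1 := pow_lt_one₀ (by positivity) h1 (by omega)
    have h3 : (1 : ℝ) ≤ 4 ^ m := one_le_pow₀ (by norm_num)
    linarith
  have key := RealRam.operations_le hn hB1 hs h4
  -- `160000 = 20000 * 8` from `(k + 1)³ ≤ 8 k³`. The constant 2000 covers the sieving and the
  -- setup, using `s ≥ 1` and `k ≥ 1`.
  have ht' : t ≤ 160000 * ((k + m) * k ^ 3) + 2000 * (s * k ^ 2) := by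
    have e1 : (k + 1) ^ 3 ≤ 8 * k ^ 3 := by
      calc (k + 1) ^ 3 ≤ (2 * k) ^ 3 := Nat.pow_le_pow_left (by omega) 3
        _ = _ := by ring
    have e2 : (k + 1) ^ 2 ≤ 4 * k ^ 2 := by
      calc (k + 1) ^ 2 ≤ (2 * k) ^ 2 := Nat.pow_le_pow_left (by omega) 2
        _ = _ := by ring
    have e3 : (k + 1) ^ 3 * (k + m) ≤ 8 * k ^ 3 * (k + m) := Nat.mul_le_mul_right _ e1
    have e4 : (k + 1) ^ 2 * s ≤ 4 * k ^ 2 * s := Nat.mul_le_mul_right _ e2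
    have e5 : k ^ 2 * 1 ≤ k ^ 2 * s := Nat.mul_le_mul_left _ hs
    have e6 : 1 * s ≤ k ^ 2 * s := Nat.mul_le_mul_right _ (Nat.one_le_pow _ _ hn)
    nlinarith
  have ht'' : (t : ℝ) ≤ 160000 * (((k + m : ℕ) : ℝ) * k ^ 3) + 2000 * (s * k ^ 2) := by
    exact_mod_cast ht'
  have p1 : 0 ≤ (k : ℝ) ^ 6 * Real.log (k * B) ^ 2 := by positivity
  have p2 : 0 ≤ (s : ℝ) * (k : ℝ) ^ 2 := by positivity
  linarith
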